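/- A digraph $\Gamma$ consists here of a finite set $V\Gamma$ of vertices and a set $A\Gamma$ of arcs, that is, of ordered pairs of distinct vertices, and it is assumed that $\Gamma$ is not undirected, i.e. $(y,x)\notin A\Gamma$ for some arc $(x,y)$. **Definitions.** An *association scheme* on a finite set $X$ is a set $\mathcal R$ of nonempty subsets of $X\times X$ that partitions $X\times X$, contains the diagonal $\{(x,x)\mid x\in X\}$, contains with each $R$ its transpose $R^{\mathrm T}$, and is such that for all $R,S,T\in\mathcal R$ the number of $z\in X$ with $(x,z)\in R$ and $(z,y)\in S$ is the same number $p_{R,S}^{T}$ for all $(x,y)\in T$. A nonempty subset $F\subseteq\mathcal R$ is *closed* if, for all $R,S\in F$, every $T\in\mathcal R$ with $p_{R^{\mathrm T},S}^{T}\neq 0$ lies in $F$. The scheme is *primitive* if for every non-diagonal $R\in\mathcal R$ the smallest closed subset containing $R$ is $\mathcal R$. For vertices $x,y$ of $\Gamma$ let $\partial(x,y)$ be the length of a shortest directed path from $x$ to $y$ and $\tilde\partial(x,y)=(\partial(x,y),\partial(y,x))$. A strongly connected digraph $\Gamma$ is *weakly distance-regular* if the nonempty relations among $\Gamma_{i}=\{(x,y)\in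 V\Gamma\times V\Gamma\mid\tilde\partial(x,y)=i\}$ form an association scheme on $V\Gamma$; it is then *primitive* if this scheme is primitive. For a finite group $G$ and a subset $S\subseteq G$ without the identity, $\mathrm{Cay}(G,S)$ is the digraph with vertex set $G$ in which $(x,y)$ is an arc if and only if $yx^{-1}\in S$ (that is, $y-x\in S$ in additive notation). A *circulant* is a digraph that is isomorphic to a Cayley digraph of a finite cyclic group. For a prime $p$ let $C_p=\mathrm{Cay}(\mathbb Z_p,\{1\})$. For a prime $r\equiv 3\pmod 4$ let the *Paley digraph* $P(r)$ be $\mathrm{Cay}(\mathbb Z_r,S)$, where $S$ is the set of nonzero squares of the field $\mathbb Z_r$. **Corollary 1.3.** Let $\Gamma$ be a digraph as above (finite, simple, not undirected). Then $\Gamma$ is a primitive weakly distance-regular circulant if and only if $\Gamma$ is isomorphic to one of the following: - $C_p$ for some prime $p$ (necessarily odd, since $\Gamma$ is not undirected); - $P(r)$ for some prime $r$ with $r\equiv 3\pmod 4$; - $\mathrm{Cay}(\mathbb Z_{13},\{1,3,9\})$. -/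

import Mathlib

/-! ### Association schemes -/

namespace AssocScheme

variable {X : Type*}

/-- `P R S x y` is the set `R(x) ∩ Sᵀ(y)`, where `R(x) = {z | (x, z) ∈ R}` and `Sᵀ` is the
transpose of `S`. -/
def P (R S : Set (X × X)) (x y : X) : Set X :=
  {z | (x, z) ∈ R ∧ (z, y) ∈ S}

/-- The set `𝓡` of relations on `X` is (the set of relations of) an association scheme on the
finite set `X`. Commutativity is not required. -/
structure IsAssociationScheme (𝓡 : Set (Set (X × X))) : Prop where
  finite : Finite X
  nonempty : ∀ R ∈ 𝓡, R.Nonempty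
  diagonal_mem : Set.diagonal X ∈ 𝓡
  cover : ⋃₀ 𝓡 = Set.univ
  disjoint : ∀ R ∈ 𝓡, ∀ S ∈ 𝓡, R ≠ S → Disjoint R S
  transpose_mem : ∀ R ∈ 𝓡, Prod.swap ⁻¹' R ∈ 𝓡
  card_const : ∀ R ∈ 𝓡, ∀ S ∈ 𝓡, ∀ T ∈ 𝓡, ∃ p : ℕ, ∀ x y, (x, y) ∈ T → (P R S x y).ncard = p

/-- The intersection number `p_{R,S}^T`: the common value of `|P R S x y|` over all
`(x, y) ∈ T` (see `interNum_eq`). -/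
noncomputable def interNum (R S T : Set (X × X)) : ℕ :=
  sInf {k | ∃ x y, (x, y) ∈ T ∧ (P R S x y).ncard = k}

theorem interNum_eq {𝓡 : Set (Set (X × X))} (h : IsAssociationScheme 𝓡) {R S T : Set (X × X)}
    (hR : R ∈ 𝓡) (hS : S ∈ 𝓡) (hT : T ∈ 𝓡) {x y : X} (hxy : (x, y) ∈ T) :
    interNum R S T = (P R S x y).ncard := by
  obtain ⟨p, hp⟩ := h.card_const R hR S hS T hT
  have : {k | ∃ x y, (x, y) ∈ T ∧ (P R S x y).ncard = k} = {p} := by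
    ext k
    constructor
    · rintro ⟨a, b, hab, rfl⟩
      exact hp a b hab
    · rintro rfl
      exact ⟨x, y, hxy, hp x y hxy⟩
  rw [interNum, this, hp x y hxy, csInf_singleton]

/-- The product `EF` of two sets of relations: all relations `T` of the scheme for which the sum
of the numbers `p_{R,S}^T` over `R ∈ E`, `S ∈ F` is nonzero, that is, for which one of these
natural numbers is nonzero. -/
def relProd (𝓡 E F : Set (Set (X × X))) : Set (Set (X × X)) :=
  {T | T ∈ 𝓡 ∧ ∃ R ∈ E, ∃ S ∈ F, interNum R S T ≠ 0}

/-- `F` is a closed subset of `𝓡`: it is a nonempty set of relations such that `RᵀS ⊆ F` for all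
`R, S ∈ F`. -/
def IsClosedSubset (𝓡 F : Set (Set (X × X))) : Prop :=
  F.Nonempty ∧ F ⊆ 𝓡 ∧ ∀ R ∈ F, ∀ S ∈ F, relProd 𝓡 {Prod.swap ⁻¹' R} {S} ⊆ F

/-- `R` generates `𝓡`: the smallest closed subset containing `R` is `𝓡` itself. -/
def Generates (𝓡 : Set (Set (X × X))) (R : Set (X × X)) : Prop :=
  IsLeast {F | IsClosedSubset 𝓡 F ∧ R ∈ F} 𝓡

/-- Every non-diagonal relation generates the scheme. -/
def IsPrimitive (𝓡 : Set (Set (X × X))) : Prop :=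
  ∀ R ∈ 𝓡, R ≠ Set.diagonal X → Generates 𝓡 R

end AssocScheme

/-! ### Digraphs -/

namespace Digraph

variable {V : Type*} {W : Type*}

/-- `Γ` and `Δ` are isomorphic digraphs. -/
def IsIsomorphic (Γ : Digraph V) (Δ : Digraph W) : Prop :=
  Nonempty (Γ.Adj ≃r Δ.Adj)

/-- `Γ.IsWalk n x y`: there is a directed walk of length `n` from `x` to `y`. -/
inductive IsWalk (Γ : Digraph V) : ℕ → V → V → Prop
  | nil (x : V) : IsWalk Γ 0 x x
  | cons {n : ℕ} {x y z : V} : Γ.Adj x y → IsWalk Γ n y z → IsWalk Γ (n + 1) x z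

/-- The one-way distance from `x` to `y`: the least length of a directed walk (equivalently, path)
from `x` to `y`, and `⊤` if there is none. -/
noncomputable def dist (Γ : Digraph V) (x y : V) : ℕ∞ :=
  ⨅ (n : ℕ) (_ : Γ.IsWalk n x y), (n : ℕ∞)

/-- The two-way distance from `x` to `y`. -/
noncomputable def twoWayDist (Γ : Digraph V) (x y : V) : ℕ∞ × ℕ∞ :=
  (Γ.dist x y, Γ.dist y x)

/-- The set of all two-way distances that occur in `Γ`. -/
def twoWayDists (Γ : Digraph V) : Set (ℕ∞ × ℕ∞) :=
  {i | ∃ x y, Γ.twoWayDist x y = i}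

/-- The relation `Γ_i` of all pairs at two-way distance `i`. -/
def distRel (Γ : Digraph V) (i : ℕ∞ × ℕ∞) : Set (V × V) :=
  {a | Γ.twoWayDist a.1 a.2 = i}

/-- The relations `Γ_i` of the attached scheme, `i` ranging over the two-way distances of `Γ`. -/
def attachedScheme (Γ : Digraph V) : Set (Set (V × V)) :=
  Γ.distRel '' Γ.twoWayDists

/-- From each vertex there is a directed walk to each vertex. -/
def IsStronglyConnected (Γ : Digraph V) : Prop :=
  ∀ x y, ∃ n, Γ.IsWalk n x y

def IsWeaklyDistanceRegular (Γ : Digraph V) : Prop :=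
  Γ.IsStronglyConnected ∧ AssocScheme.IsAssociationScheme Γ.attachedScheme

/-- The attached scheme is primitive. -/
def IsPrimitive (Γ : Digraph V) : Prop :=
  AssocScheme.IsPrimitive Γ.attachedScheme

/-- The Cayley digraph `Cay(G, S)` of an additively written group `G`: `(x, y)` is an arc if and
only if `y - x ∈ S`. It is meant for sets `S` that do not contain `0`. -/
def cayley {G : Type*} [AddGroup G] (S : Set G) : Digraph G where
  Adj x y := y - x ∈ S

/-- `Γ` is isomorphic to `Cay(G, S)` for some finite cyclic group `G`, written additively, and
some subset `S` of `G` without the identity. -/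
def IsCirculant (Γ : Digraph V) : Prop :=
  ∃ (G : Type) (_ : AddGroup G) (_ : Finite G) (_ : IsAddCyclic G) (S : Set G),
    0 ∉ S ∧ Γ.IsIsomorphic (cayley S)

/-- `C_n`, the Cayley digraph `Cay(ℤ/n, {1})`. -/
def cycle (n : ℕ) : Digraph (ZMod n) :=
  cayley {1}

/-- The Paley digraph of a finite field `K` (whose order is supposed to be `3` modulo `4`): the
Cayley digraph of the additive group of `K` with respect to the set of all squares in the
multiplicative group of `K`. -/
def paley (K : Type*) [Field K] : Digraph K :=
  cayley {a | ∃ u : Kˣ, a = ((u ^ 2 : Kˣ) : K)}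

end Digraph

/-! ### Integer-valued lengths on a field of prime order -/

/-! Forward direction. Fix an isomorphism with `Cay(Z_n, S)` and let `l` be the word length for `S`.
The pairs `(l x, l (-x))` cut `Z_n` into classes, the basic sets of a Schur ring, and primitivity
says that no proper subgroup contains a nonzero class. An arc that is not reversed gives a
nonsymmetric class. Schur's theorem on `q`-th powers and a count of differences then exclude
composite `n` (`prime_of_primitive`).

For prime `p`, Schur's theorem also shows that multiplications permute the classes
(`IsSchurLength.mul_sim`). So the class `K` of `1` is a multiplicative subgroup, the nonzero classes
are its cosets, and none is symmetric. Rescale so that `1` is a generator lying on a shortest closed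
walk. If that walk has at least four steps, counting sums of two elements of `K` makes some set
invariant under translation by the difference of two steps. Hence all steps are equal, and the
digraph is `C_p`.

If it has three steps, `1 + K` meets only the classes of types `(1,2)`, `(2,1)`, `(2,3)`. When
`(2,3)` is missing, `K ∪ -K` is everything but `0` and `K` is the set of nonzero squares. When it
occurs, at `d`, one gets `-d² ∈ K`. Double counting then gives quadratic relations between
cyclotomic numbers, which force `|K| = 3`, `d = 2` and `p ∣ 4³ + 1 = 65`, so `p = 13`.

Converse. In each listed digraph, elements of equal two-way length differ by a multiplier preserving
`S`. Affine automorphisms are therefore transitive on each relation, which gives a scheme; a closed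
subset yields a subgroup of `Z_p`, which gives primitivity. -/

namespace CyclotomicLength

/-- `x` and `y` have the same two-way length. -/
def Sim {G : Type*} [Neg G] (l : G → ℕ) (x y : G) : Prop :=
  l x = l y ∧ l (-x) = l (-y)

instance {G : Type*} [Neg G] (l : G → ℕ) (x y : G) : Decidable (Sim l x y) :=
  inferInstanceAs (Decidable (_ ∧ _))

/-- `l` is a word length on `ZMod p` whose two-way length classes are permuted by the
multiplications, and for which some generator is not the inverse of a generator. -/
structure IsCyclotomicLength {p : ℕ} (l : ZMod p → ℕ) : Prop where
  eq_zero_iff : ∀ x, l x = 0 ↔ x = 0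
  add_le : ∀ x y, l (x + y) ≤ l x + l y
  exists_sub : ∀ x n, l x = n + 1 → ∃ s, l s = 1 ∧ l (x - s) = n
  mul_sim : ∀ c x y, c ≠ 0 → Sim l x y → Sim l (c * x) (c * y)
  directed : ∃ s, l s = 1 ∧ l (-s) ≠ 1

variable {p : ℕ} [Fact p.Prime] {l : ZMod p → ℕ}

theorem Sim.symm {G : Type*} [Neg G] {l : G → ℕ} {x y : G} (h : Sim l x y) : Sim l y x :=
  ⟨h.1.symm, h.2.symm⟩

theorem Sim.trans {G : Type*} [Neg G] {l : G → ℕ} {x y z : G} (h : Sim l x y)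
    (h' : Sim l y z) : Sim l x z :=
  ⟨h.1.trans h'.1, h.2.trans h'.2⟩

theorem isSquare_mul_of_not_isSquare {x y : ZMod p} (hx : ¬ IsSquare x) (hy : ¬ IsSquare y) :
    IsSquare (x * y) := by
  have hx0 : x ≠ 0 := fun h => hx (h ▸ IsSquare.zero)
  have hy0 : y ≠ 0 := fun h => hy (h ▸ IsSquare.zero)
  rw [← quadraticChar_one_iff_isSquare (mul_ne_zero hx0 hy0), map_mul,
    quadraticChar_neg_one_iff_not_isSquare.2 hx, quadraticChar_neg_one_iff_not_isSquare.2 hy]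
  norm_num

/-- A nonempty set that misses `0` is invariant under no nontrivial translation. -/
theorem eq_zero_of_add_invariant (A : ZMod p → Prop) (a h : ZMod p) (ha : A a) (h0 : ¬ A 0)
    (hA : ∀ x, A x → A (x + h)) : h = 0 := by
  by_contra hne
  have hn : ∀ n : ℕ, A (a + n * h) := by
    intro n
    induction n with
    | zero => simpa using ha
    | succ n ih =>
      have := hA _ ih
      push_cast
      convert this using 1
      ring
  apply h0
  have := hn (-a / h).val
  rw [ZMod.natCast_zmod_val, div_mul_cancel₀ _ hne, add_neg_cancel] at this
  exact this

namespace IsCyclotomicLength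

variable (H : IsCyclotomicLength l)
include H

theorem zero : l 0 = 0 := (H.eq_zero_iff 0).2 rfl

theorem ne_zero_of_sim {x y : ZMod p} (h : Sim l x y) (hy : y ≠ 0) : x ≠ 0 := by
  rintro rfl
  have h1 := h.1
  rw [H.zero] at h1
  exact hy ((H.eq_zero_iff y).1 h1.symm)

/-- A multiplication carries `x` to a generator `s` whose inverse is not a generator. A symmetric
class of `x` would make the class of `s` symmetric. -/
theorem length_ne_neg {x : ZMod p} (hx : x ≠ 0) : l x ≠ l (-x) := by
  intro h
  obtain ⟨s, hs, hs'⟩ := H.directed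
  have hs0 : s ≠ 0 := by
    rintro rfl
    rw [H.zero] at hs
    omega
  have := H.mul_sim (s / x) x (-x) (div_ne_zero hs0 hx) ⟨h, by rw [neg_neg, h]⟩
  rw [mul_neg, div_mul_cancel₀ _ hx] at this
  exact hs' (by rw [← this.1, hs])

/-- With the next lemmas: the class `K` of `1` is a subgroup of the multiplicative group, and the
class of each nonzero `y` is the coset `yK`. -/
theorem sim_mul_of_sim_one {x y : ZMod p} (hx : Sim l x 1) (hy : y ≠ 0) : Sim l (y * x) y := by
  simpa using H.mul_sim y x 1 hy hx

theorem sim_div_of_sim_one {x y : ZMod p} (hx : Sim l x 1) (hy : y ≠ 0) : Sim l (y / x) y := by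
  have hx0 := H.ne_zero_of_sim hx one_ne_zero
  have := H.sim_mul_of_sim_one hx (div_ne_zero hy hx0)
  rw [div_mul_cancel₀ _ hx0] at this
  exact this.symm

theorem sim_one_div {x y : ZMod p} (hy : y ≠ 0) (h : Sim l x y) : Sim l (x / y) 1 := by
  have := H.mul_sim y⁻¹ x y (inv_ne_zero hy) h
  rwa [inv_mul_cancel₀ hy, mul_comm, ← div_eq_mul_inv] at this

theorem sim_one_mul {x y : ZMod p} (hx : Sim l x 1) (hy : Sim l y 1) : Sim l (x * y) 1 :=
  (H.sim_mul_of_sim_one hy (H.ne_zero_of_sim hx one_ne_zero)).trans hx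

theorem sim_one_inv {x : ZMod p} (hx : Sim l x 1) : Sim l x⁻¹ 1 := by
  simpa using H.sim_div_of_sim_one hx one_ne_zero

/-- Multiplying by a nonzero constant. -/
theorem rescale {s : ZMod p} (hs : s ≠ 0) : IsCyclotomicLength (fun x => l (s * x)) where
  eq_zero_iff x := by rw [H.eq_zero_iff, mul_eq_zero, or_iff_right hs]
  add_le x y := by rw [mul_add]; exact H.add_le _ _
  exists_sub x n h := by
    obtain ⟨t, ht, ht'⟩ := H.exists_sub _ _ h
    refine ⟨t / s, ?_, ?_⟩
    · rwa [mul_div_cancel₀ _ hs]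
    · rwa [mul_sub, mul_div_cancel₀ _ hs]
  mul_sim c x y hc h := by
    have := H.mul_sim c (s * x) (s * y) hc ⟨h.1, by rw [← mul_neg, ← mul_neg]; exact h.2⟩
    unfold Sim at *
    simp only [mul_neg] at *
    rw [mul_left_comm, mul_left_comm s c y]
    exact this
  directed := by
    obtain ⟨t, ht, ht'⟩ := H.directed
    refine ⟨t / s, ?_, ?_⟩
    · rwa [mul_div_cancel₀ _ hs]
    · rwa [mul_neg, mul_div_cancel₀ _ hs]

theorem list_sum_le (L : List (ZMod p)) (hL : ∀ x ∈ L, l x = 1) : l L.sum ≤ L.length := by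
  induction L with
  | nil => simp [H.zero]
  | cons a L ih =>
    have h1 := hL a (by simp)
    have h2 := ih fun x hx => hL x (by simp [hx])
    have := H.add_le a L.sum
    simp only [List.sum_cons, List.length_cons]
    omega

theorem exists_list (n : ℕ) : ∀ x, l x = n →
    ∃ L : List (ZMod p), (∀ s ∈ L, l s = 1) ∧ L.length = n ∧ L.sum = x := by
  induction n with
  | zero =>
    intro x hx
    exact ⟨[], by simp, rfl, ((H.eq_zero_iff x).1 hx).symm⟩
  | succ n ih =>
    intro x hx
    obtain ⟨s, hs, hs'⟩ := H.exists_sub x n hx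
    obtain ⟨L, h1, h2, h3⟩ := ih _ hs'
    refine ⟨s :: L, ?_, by simp [h2], by simp [h3]⟩
    intro t ht
    rcases List.mem_cons.1 ht with rfl | ht
    · exact hs
    · exact h1 t ht

section Minimal

variable (h1 : l 1 = 1) (hmin : ∀ s, l s = 1 → l (-1) ≤ l (-s))
include h1 hmin

omit h1 in
/-- In a closed walk of minimal length each proper part is a geodesic. -/
theorem closed_list_left (a : ZMod p) (L M : List (ZMod p)) (ha : l a = 1)
    (hL : ∀ s ∈ L, l s = 1) (hM : ∀ s ∈ M, l s = 1) (hlen : L.length + M.length = l (-1))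
    (hsum : a + L.sum + M.sum = 0) : l M.sum = M.length := by
  have e1 := hmin a ha
  have e2 := H.list_sum_le L hL
  have e3 := H.list_sum_le M hM
  have e4 := H.add_le L.sum M.sum
  have : L.sum + M.sum = -a := by linear_combination hsum
  rw [this] at e4
  omega

end Minimal

end IsCyclotomicLength

end CyclotomicLength

/-! ### Shortest closed walk of length at least four: the directed cycle -/

namespace CyclotomicLength

variable {p : ℕ} [Fact p.Prime] {l : ZMod p → ℕ}

namespace IsCyclotomicLength

variable (H : IsCyclotomicLength l)
include H

section LargeGirth

variable (hmin : ∀ s, l s = 1 → l (-1) ≤ l (-s))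
include hmin

theorem sim_one_of_closed_list (h1 : l 1 = 1) (a : ZMod p) (L : List (ZMod p)) (ha : l a = 1)
    (hL : ∀ s ∈ L, l s = 1) (hlen : L.length = l (-1)) (hsum : a + L.sum = 0) : Sim l a 1 := by
  refine ⟨by rw [ha, h1], ?_⟩
  have e1 := hmin a ha
  have e2 := H.list_sum_le L hL
  have : L.sum = -a := by linear_combination hsum
  rw [this] at e2
  omega

/-- The group is commutative, so any two steps of a minimal closed walk may be taken consecutive;
every proper part of the walk is a geodesic. -/
theorem length_pair_of_closed_list (a b c : ZMod p) (L : List (ZMod p)) (ha : l a = 1)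
    (hb : l b = 1) (hc : l c = 1) (hL : ∀ s ∈ L, l s = 1) (hlen : L.length + 2 = l (-1))
    (hsum : a + b + c + L.sum = 0) : l (a + b) = 2 ∧ l (-(a + b)) = l (-1) - 1 := by
  constructor
  · have := H.closed_list_left hmin c L [a, b] hc hL (by simp [ha, hb]) (by simp [hlen])
      (by simp; linear_combination hsum)
    simpa using this
  · have := H.closed_list_left hmin a [b] (c :: L) ha (by simp [hb])
      (by simpa [hc] using hL) (by simp; omega) (by simp; linear_combination hsum)
    have e : (c :: L).sum = -(a + b) := by simp; linear_combination hsum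
    rw [e, List.length_cons] at this
    omega

omit hmin in
-- If `a + t` lies in the class of `z`, then `k = z / (a + t)` lies in `K`, and `z = ka + kt` is a
-- sum of two elements of `K`. The summand `ka` determines `t`.
theorem card_representations_le {a z : ZMod p} (ha : Sim l a 1) (hz : z ≠ 0) :
    (Finset.univ.filter fun t => Sim l t 1 ∧ Sim l (a + t) z).card ≤
      (Finset.univ.filter fun u => Sim l u 1 ∧ Sim l (z - u) 1).card := by
  have ha0 := H.ne_zero_of_sim ha one_ne_zero
  apply Finset.card_le_card_of_injOn (fun t => a * z / (a + t))
  · intro t ht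
    simp only [Finset.coe_filter, Finset.mem_univ, true_and, Set.mem_ofPred_eq] at ht ⊢
    have h0 := H.ne_zero_of_sim ht.2 hz
    have hk : Sim l (z / (a + t)) 1 := H.sim_one_div h0 ht.2.symm
    constructor
    · rw [mul_div_assoc]
      exact H.sim_one_mul ha hk
    · have : z - a * z / (a + t) = z / (a + t) * t := by field_simp; ring
      rw [this]
      exact H.sim_one_mul hk ht.1
  · intro t ht t' ht' h
    simp only [Finset.coe_filter, Finset.mem_univ, true_and, Set.mem_ofPred_eq] at ht ht' h
    have h0 := H.ne_zero_of_sim ht.2 hz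
    have h0' := H.ne_zero_of_sim ht'.2 hz
    rw [div_eq_div_iff h0 h0'] at h
    have := mul_left_cancel₀ (mul_ne_zero ha0 hz) h
    linear_combination -this

/-- Replacing `c, d` by `u, c + d - u` leaves the walk closed and minimal, so `a + u` is again a sum
of two of its steps; the opposite inequality of cardinalities is `card_representations_le`. The
point is that the right-hand side does not depend on `c` and `d`. -/
theorem representations_eq_of_closed_list (h1 : l 1 = 1) (a b c d : ZMod p) (L : List (ZMod p))
    (ha : l a = 1) (hb : l b = 1) (hc : l c = 1) (hd : l d = 1) (hL : ∀ s ∈ L, l s = 1)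
    (hlen : L.length + 3 = l (-1)) (hsum : a + b + c + d + L.sum = 0) :
    (Finset.univ.filter fun u => Sim l u 1 ∧ Sim l (c + d - u) 1) =
      Finset.univ.filter fun t => Sim l t 1 ∧ l (a + t) = 2 ∧ l (-(a + t)) = l (-1) - 1 := by
  have hcd := H.length_pair_of_closed_list hmin c d a (b :: L) hc hd ha (by simpa [hb] using hL)
    (by simp; omega) (by simp; linear_combination hsum)
  have hz : c + d ≠ 0 := by
    intro h
    rw [h, H.zero] at hcd
    omega
  have haK : Sim l a 1 := H.sim_one_of_closed_list hmin h1 a (b :: c :: d :: L) ha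
    (by simpa [hb, hc, hd] using hL) (by simp; omega) (by simp; linear_combination hsum)
  apply Finset.eq_of_subset_of_card_le
  · intro u
    simp only [Finset.mem_filter, Finset.mem_univ, true_and]
    rintro ⟨hu, hv⟩
    refine ⟨hu, ?_⟩
    exact H.length_pair_of_closed_list hmin a u (c + d - u) (b :: L) ha (hu.1.trans h1)
      (hv.1.trans h1) (by simpa [hb] using hL) (by simp; omega)
      (by simp; linear_combination hsum)
  · refine le_trans (le_of_eq ?_) (H.card_representations_le haK hz)
    refine congrArg Finset.card (Finset.filter_congr fun t _ => and_congr_right fun _ => ?_)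
    rw [Sim, hcd.1, hcd.2]

/-- The sums equal to `c + d` and those equal to `b + d` have the same set of first summands. Both
`u ↦ c + d - u` and `u ↦ b + d - u` preserve this set, hence so does their composite, translation by
`c - b`. -/
theorem eq_of_closed_list (h1 : l 1 = 1) (a b c d : ZMod p) (L : List (ZMod p))
    (ha : l a = 1) (hb : l b = 1) (hc : l c = 1) (hd : l d = 1) (hL : ∀ s ∈ L, l s = 1)
    (hlen : L.length + 3 = l (-1)) (hsum : a + b + c + d + L.sum = 0) : b = c := by
  have e1 := H.representations_eq_of_closed_list hmin h1 a b c d L ha hb hc hd hL hlen hsum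
  have e2 := H.representations_eq_of_closed_list hmin h1 a c b d L ha hc hb hd hL hlen
    (by linear_combination hsum)
  rw [← e2] at e1
  have e3 : ∀ u, (Sim l u 1 ∧ Sim l (c + d - u) 1) ↔ (Sim l u 1 ∧ Sim l (b + d - u) 1) := by
    intro u
    simpa using Finset.ext_iff.1 e1 u
  have hcK : Sim l c 1 := H.sim_one_of_closed_list hmin h1 c (a :: b :: d :: L) hc (by simpa [ha, hb, hd] using hL)
    (by simp; omega) (by simp; linear_combination hsum)
  have hdK : Sim l d 1 := H.sim_one_of_closed_list hmin h1 d (a :: b :: c :: L) hd (by simpa [ha, hb, hc] using hL)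
    (by simp; omega) (by simp; linear_combination hsum)
  have := eq_zero_of_add_invariant (fun u => Sim l u 1 ∧ Sim l (c + d - u) 1) c (c - b)
    ⟨hcK, by simpa using hdK⟩ (fun h => H.ne_zero_of_sim h.1 one_ne_zero rfl) ?_
  · exact (sub_eq_zero.1 this).symm
  · intro x hx
    have hx' := (e3 x).1 hx
    have := (e3 (b + d - x)).2 ⟨hx'.2, by simpa using hx'.1⟩
    refine ⟨?_, ?_⟩
    · convert this.2 using 1
      ring
    · convert this.1 using 1
      ring

/-- If the shortest closed walk has length at least four, there is only one generator. -/
theorem eq_one_of_three_le (h1 : l 1 = 1) (hq : 3 ≤ l (-1)) (s : ZMod p) (hs : l s = 1) :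
    s = 1 := by
  obtain ⟨L, hL, hlen, hsum⟩ := H.exists_list _ (-1) rfl
  have hall : ∀ b ∈ L, b = 1 := by
    intro b hb
    obtain ⟨L₁, L₂, rfl⟩ := List.append_of_mem hb
    obtain ⟨c, d, R, hR⟩ : ∃ c d R, L₁ ++ L₂ = c :: d :: R := by
      have : 2 ≤ (L₁ ++ L₂).length := by simp at hlen ⊢; omega
      match L₁ ++ L₂, this with
      | c :: d :: R, _ => exact ⟨c, d, R, rfl⟩
    have hRs : ∀ s ∈ c :: d :: R, l s = 1 := by
      intro s hs
      rw [← hR] at hs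
      apply hL
      simp at hs ⊢
      tauto
    have hlen' : (c :: d :: R).length + 1 = l (-1) := by
      rw [← hR, ← hlen]
      simp
      omega
    have hsum' : b + (c :: d :: R).sum = -1 := by
      rw [← hR, ← hsum]
      simp
      ring
    simp only [List.length_cons, List.sum_cons] at hlen' hsum'
    -- The closed walk consists of the step `1` followed by a geodesic to `-1`. Comparing `1` with
    -- `b` takes two further steps `c`, `d`, available because `3 ≤ l (-1)`.
    refine (H.eq_of_closed_list hmin h1 c 1 b d R ?_ h1 ?_ ?_ ?_ ?_ ?_).symm
    · exact hRs c (by simp)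
    · exact hL b hb
    · exact hRs d (by simp)
    · exact fun s hs => hRs s (by simp [hs])
    · omega
    · linear_combination hsum'
  -- The closed walk is `l (-1) + 1` copies of `1`, so `p ≤ l (-1) + 1`. Another generator `s` has
  -- `l (-s) ≥ l (-1) ≥ p - 1`, while `-s` is reached by `(-s).val < p` steps `1`; this leaves only
  -- `-s = -1`.
  have hp : ((l (-1) + 1 : ℕ) : ZMod p) = 0 := by
    have := List.eq_replicate_of_mem hall
    rw [this, List.sum_replicate, hlen] at hsum
    push_cast
    simp at hsum
    rw [hsum, neg_add_cancel]
  have hle := Nat.le_of_dvd (by omega) ((ZMod.natCast_eq_zero_iff _ _).1 hp)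
  by_contra hne
  have e1 := hmin s hs
  have e2 := H.list_sum_le (List.replicate (-s).val 1) (by
    intro x hx
    rw [List.eq_of_mem_replicate hx, h1])
  rw [List.sum_replicate, List.length_replicate, nsmul_eq_mul, ZMod.natCast_zmod_val,
    mul_one] at e2
  have e3 := ZMod.val_lt (-s)
  have e4 : (-s).val + 1 = p := by omega
  apply hne
  have e5 : (((-s).val + 1 : ℕ) : ZMod p) = 0 := by rw [e4, ZMod.natCast_self]
  push_cast at e5
  rw [ZMod.natCast_zmod_val] at e5
  linear_combination -e5

end LargeGirth

end IsCyclotomicLength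

end CyclotomicLength

/-! ### Shortest closed walk of length three: possible types of `1 + w` and `1 - w` -/

namespace CyclotomicLength

variable {p : ℕ} [Fact p.Prime] {l : ZMod p → ℕ}

namespace IsCyclotomicLength

variable (H : IsCyclotomicLength l)
include H

theorem two_le_neg {s : ZMod p} (hs : l s = 1) : 2 ≤ l (-s) := by
  have h0 : s ≠ 0 := by
    rintro rfl
    rw [H.zero] at hs
    omega
  have e1 := H.length_ne_neg h0
  have e2 : l (-s) ≠ 0 := fun h => h0 (neg_eq_zero.1 ((H.eq_zero_iff _).1 h))
  omega

section GirthThree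

variable (h1 : l 1 = 1) (h2 : l (-1) = 2)
include h1 h2

omit H in
theorem sim_one_iff (x : ZMod p) : Sim l x 1 ↔ l x = 1 ∧ l (-x) = 2 := by
  rw [Sim, h1, h2]

/-- In a closed walk `1 + u + v = 0` of generators, each inverse is the sum of the other two steps,
so it has length exactly `2`. -/
theorem exists_add_eq_neg_one : ∃ v, Sim l v 1 ∧ Sim l (-1 - v) 1 := by
  obtain ⟨u, hu, hu'⟩ := H.exists_sub (-1) 1 h2
  have e1 := H.two_le_neg hu
  have e2 := H.two_le_neg hu'
  have e3 := H.add_le 1 (-1 - u)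
  have e4 := H.add_le 1 u
  rw [show (1 : ZMod p) + (-1 - u) = -u by ring] at e3
  rw [show (1 : ZMod p) + u = -(-1 - u) by ring] at e4
  refine ⟨u, (sim_one_iff h1 h2 _).2 ⟨hu, ?_⟩, (sim_one_iff h1 h2 _).2 ⟨hu', ?_⟩⟩ <;> omega

omit h1 h2 in
theorem sim_one_neg_one_sub_inv {w : ZMod p} (hw : Sim l w 1) (hw' : Sim l (-1 - w) 1) :
    Sim l (-1 - w⁻¹) 1 := by
  have h0 := H.ne_zero_of_sim hw one_ne_zero
  have : -1 - w⁻¹ = (-1 - w) * w⁻¹ := by field_simp; ring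
  rw [this]
  exact H.sim_one_mul hw' (H.sim_one_inv hw)

/-- Multiplication by `s` carries representations of `-1` as a sum over `K` to those of `-s`, so the
inclusion `hT` is an equality. Composing the reflections `u ↦ -1 - u` and `u ↦ -s - u` then gives
invariance under translation by `1 - s`. -/
theorem eq_one_of_neg_sub {s : ZMod p} (hs : Sim l s 1)
    (hT : ∀ u, Sim l u 1 → Sim l (-s - u) 1 → Sim l (-1 - u) 1) : s = 1 := by
  have hs0 := H.ne_zero_of_sim hs one_ne_zero
  have heq : (Finset.univ.filter fun u => Sim l u 1 ∧ Sim l (-s - u) 1) =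
      Finset.univ.filter fun u => Sim l u 1 ∧ Sim l (-1 - u) 1 := by
    apply Finset.eq_of_subset_of_card_le
    · intro u
      simp only [Finset.mem_filter, Finset.mem_univ, true_and]
      exact fun h => ⟨h.1, hT u h.1 h.2⟩
    · apply Finset.card_le_card_of_injOn (fun u => s * u)
      · intro u
        simp only [Finset.coe_filter, Finset.mem_univ, true_and, Set.mem_ofPred_eq]
        rintro ⟨hu, hu'⟩
        refine ⟨H.sim_one_mul hs hu, ?_⟩
        rw [show -s - s * u = s * (-1 - u) by ring]
        exact H.sim_one_mul hs hu'
      · exact fun u _ v _ h => mul_left_cancel₀ hs0 h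
  have hiff : ∀ u, (Sim l u 1 ∧ Sim l (-s - u) 1) ↔ (Sim l u 1 ∧ Sim l (-1 - u) 1) := by
    intro u
    simpa using Finset.ext_iff.1 heq u
  obtain ⟨v, hv, hv'⟩ := H.exists_add_eq_neg_one h1 h2
  have := eq_zero_of_add_invariant (fun u => Sim l u 1 ∧ Sim l (-1 - u) 1) v (1 - s)
    ⟨hv, hv'⟩ (fun h => H.ne_zero_of_sim h.1 one_ne_zero rfl) ?_
  · linear_combination -this
  · rintro x ⟨hx, hx'⟩
    have := (hiff (-1 - x)).2 ⟨hx', by simpa using hx⟩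
    have := (hiff (-s - (-1 - x))).1 ⟨this.2, by simpa using hx'⟩
    convert this using 2 <;> ring

/-- `-(x + a) = b + c` has length at most `2`, and at least `2` because adding `a` gives `-x` of
length `3`. As `x + a` has length at most `2` and no class is symmetric, its length is `1`. -/
theorem sim_one_add_of_neg_length_three {x a b c : ZMod p} (hx : l x = 1) (hx' : l (-x) = 3)
    (ha : l a = 1) (hb : l b = 1) (hc : l c = 1) (hsum : x + a + b + c = 0) :
    Sim l (x + a) 1 := by
  have e1 := H.add_le x a
  have e2 := H.add_le b c
  rw [show b + c = -(x + a) by linear_combination hsum] at e2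
  have e3 := H.add_le (-(x + a)) a
  rw [show -(x + a) + a = -x by ring] at e3
  have h0 : x + a ≠ 0 := by
    intro h
    rw [h, neg_zero, H.zero] at e3
    omega
  have e4 := H.length_ne_neg h0
  have e5 : l (x + a) ≠ 0 := fun h => h0 ((H.eq_zero_iff _).1 h)
  rw [sim_one_iff h1 h2]
  omega

/-- Otherwise `a` too has type `(1,3)`. The previous lemma at `a` gives `a + b` length `1`; at `x`
it puts `x + c = -(a + b)` in `K`, so `a + b` has length `2`. -/
theorem sim_one_of_neg_length_three {x a b c : ZMod p} (hx : l x = 1) (hx' : l (-x) = 3)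
    (ha : l a = 1) (hb : l b = 1) (hc : l c = 1) (hsum : x + a + b + c = 0) :
    Sim l a 1 := by
  have e1 := H.two_le_neg ha
  have e2 := H.add_le (x + b) c
  have e3 := H.add_le x b
  rw [show x + b + c = -a by linear_combination hsum] at e2
  rw [sim_one_iff h1 h2]
  refine ⟨ha, ?_⟩
  by_contra hne
  have e4 := H.sim_one_add_of_neg_length_three h1 h2 ha (by omega) hb hx hc
    (by linear_combination hsum)
  have e5 := H.sim_one_add_of_neg_length_three h1 h2 hx hx' hc ha hb
    (by linear_combination hsum)
  rw [sim_one_iff h1 h2] at e4 e5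
  rw [show -(x + c) = a + b by linear_combination -hsum] at e5
  omega

/-- In a closed walk `x + a + b + c = 0`, divide by `a ∈ K` and put `s = 1 + x/a ∈ K`. If `u + v =
-s` over `K`, then `x/a + v + 1 + u = 0` is such a walk again, so `-1 - u = x/a + v` lies in `K`.
Thus `s = 1`, which is absurd. -/
theorem neg_length_ne_three {x : ZMod p} (hx : l x = 1) : l (-x) ≠ 3 := by
  intro hx'
  obtain ⟨a, ha, ha'⟩ := H.exists_sub (-x) 2 hx'
  obtain ⟨b, hb, hb'⟩ := H.exists_sub (-x - a) 1 ha'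
  have hx0 : x ≠ 0 := by
    rintro rfl
    rw [H.zero] at hx
    omega
  have haK := H.sim_one_of_neg_length_three h1 h2 hx hx' ha hb hb' (by ring)
  have ha0 := H.ne_zero_of_sim haK one_ne_zero
  have hy := H.sim_div_of_sim_one haK hx0
  have hs : Sim l (1 + x / a) 1 := by
    have := H.sim_one_mul (H.sim_one_add_of_neg_length_three h1 h2 hx hx' ha hb hb' (by ring))
      (H.sim_one_inv haK)
    convert this using 1
    field_simp
    ring
  have := H.eq_one_of_neg_sub h1 h2 hs ?_
  · have h0 : x / a = 0 := by linear_combination this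
    exact div_ne_zero hx0 ha0 h0
  · intro u hu hv
    have := H.sim_one_add_of_neg_length_three h1 h2 (hy.1.trans hx) (hy.2.trans hx')
      (hv.1.trans h1) h1 (hu.1.trans h1) (by ring)
    convert this using 1
    ring

theorem length_sub_of_neg_length_four {w v : ZMod p} (hw : Sim l w 1) (h4 : l (-(1 + w)) = 4)
    (hv : Sim l v 1) (hv' : Sim l (-1 - v) 1) : l (w - v) = 2 ∧ l (-(w - v)) = 3 := by
  rw [sim_one_iff h1 h2] at hw hv hv'
  have e1 := H.add_le (-(w - v)) (-1 - v)
  rw [show -(w - v) + (-1 - v) = -(1 + w) by ring] at e1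
  have e2 := H.add_le v (-w)
  rw [show v + -w = -(w - v) by ring] at e2
  have e3 := H.add_le w (-v)
  rw [← sub_eq_add_neg] at e3
  have h0 : w - v ≠ 0 := by
    intro h
    rw [h, neg_zero, H.zero] at e1
    omega
  have e4 := H.length_ne_neg h0
  have e5 : l (w - v) ≠ 0 := fun h => h0 ((H.eq_zero_iff _).1 h)
  have e6 : l (w - v) ≠ 1 := fun h => H.neg_length_ne_three h1 h2 h (by omega)
  omega

/-- The previous lemma applies to `w, v` and, after division, to `w⁻¹, v⁻¹`. Both `w - v` and `w⁻¹ -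
v⁻¹` would have type `(2,3)`, but the latter is `-(w - v)` times an element of `K`. -/
theorem neg_length_one_add_ne_four {w : ZMod p} (hw : Sim l w 1) : l (-(1 + w)) ≠ 4 := by
  intro h4
  have hw0 := H.ne_zero_of_sim hw one_ne_zero
  obtain ⟨v, hv, hv'⟩ := H.exists_add_eq_neg_one h1 h2
  have hv0 := H.ne_zero_of_sim hv one_ne_zero
  have e1 := H.length_sub_of_neg_length_four h1 h2 hw h4 hv hv'
  have h0 : w - v ≠ 0 := by
    intro h
    rw [h, H.zero] at e1
    omega
  have e2 := H.sim_div_of_sim_one hv h0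
  have hw1 : 1 + w ≠ 0 := by
    intro h
    rw [h, neg_zero, H.zero] at h4
    omega
  have e3 := H.sim_div_of_sim_one hw hw1
  rw [show (1 + w) / w = 1 + w⁻¹ by field_simp; ring] at e3
  have e4 := H.length_sub_of_neg_length_four h1 h2 (H.sim_one_inv hw) (e3.2.trans h4)
    (H.sim_one_inv hv) (H.sim_one_neg_one_sub_inv hv hv')
  have h0' : w⁻¹ - v⁻¹ ≠ 0 := by
    intro h
    rw [h, H.zero] at e4
    omega
  have e5 := H.sim_mul_of_sim_one hw h0'
  rw [show (w⁻¹ - v⁻¹) * w = -((w - v) / v) by field_simp; ring] at e5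
  have f1 := e2.2
  have f2 := e5.1
  omega

theorem sim_one_add_cases {w : ZMod p} (hw : Sim l w 1) :
    Sim l (1 + w) 1 ∨ Sim l (-(1 + w)) 1 ∨ (l (1 + w) = 2 ∧ l (-(1 + w)) = 3) := by
  have e0 := H.neg_length_one_add_ne_four h1 h2 hw
  have hw' := (sim_one_iff h1 h2 w).1 hw
  have e1 := H.add_le 1 w
  have e2 := H.add_le (-1) (-w)
  rw [← neg_add] at e2
  have h0 : 1 + w ≠ 0 := by
    intro h
    rw [show w = -1 by linear_combination h] at hw'
    omega
  have e4 := H.length_ne_neg h0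
  have e5 : l (1 + w) ≠ 0 := fun h => h0 ((H.eq_zero_iff _).1 h)
  have e6 : l (-(1 + w)) ≠ 0 := fun h => h0 (neg_eq_zero.1 ((H.eq_zero_iff _).1 h))
  have e7 : l (1 + w) = 1 → l (-(1 + w)) ≠ 3 := H.neg_length_ne_three h1 h2
  rw [sim_one_iff h1 h2, sim_one_iff h1 h2, neg_neg]
  omega

theorem sim_one_sub_cases {w : ZMod p} (hw : Sim l w 1) (hne : w ≠ 1) :
    Sim l (1 - w) 1 ∨ Sim l (-(1 - w)) 1 ∨ (l (1 - w) = 2 ∧ l (-(1 - w)) = 3) ∨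
      (l (1 - w) = 3 ∧ l (-(1 - w)) = 2) := by
  have hw' := (sim_one_iff h1 h2 w).1 hw
  have e1 := H.add_le 1 (-w)
  have e2 := H.add_le (-1) w
  rw [← sub_eq_add_neg] at e1
  rw [show -1 + w = -(1 - w) by ring] at e2
  have h0 : 1 - w ≠ 0 := sub_ne_zero.2 hne.symm
  have e4 := H.length_ne_neg h0
  have e5 : l (1 - w) ≠ 0 := fun h => h0 ((H.eq_zero_iff _).1 h)
  have e6 : l (-(1 - w)) ≠ 0 := fun h => h0 (neg_eq_zero.1 ((H.eq_zero_iff _).1 h))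
  have e7 : l (1 - w) = 1 → l (-(1 - w)) ≠ 3 := H.neg_length_ne_three h1 h2
  have e8 : l (-(1 - w)) = 1 → l (- -(1 - w)) ≠ 3 := H.neg_length_ne_three h1 h2
  rw [neg_neg] at e8
  rw [sim_one_iff h1 h2, sim_one_iff h1 h2, neg_neg]
  omega

end GirthThree

end IsCyclotomicLength

end CyclotomicLength

/-! ### No class of type `(2,3)` in `1 + K`: the Paley digraph -/

namespace CyclotomicLength

variable {p : ℕ} [Fact p.Prime] {l : ZMod p → ℕ}

namespace IsCyclotomicLength

variable (H : IsCyclotomicLength l)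
include H

section GirthThree

variable (h1 : l 1 = 1) (h2 : l (-1) = 2)
include h1 h2

/-- Adding `1` keeps `{0} ∪ K ∪ -K` stable, hence it is everything. The delicate point is `1 - w`:
if it is outside `±K`, write `-w = u + v` over `K`. Were `1 + u` in `K`, then `1 - w = (1 + u) + v`
would be in `±K`; so `-1 - u ∈ K`, and `eq_one_of_neg_sub` gives `w = 1`. -/
theorem sim_one_or_neg (hD : ∀ w, Sim l w 1 → ¬ (l (1 + w) = 2 ∧ l (-(1 + w)) = 3)) {x : ZMod p}
    (hx : x ≠ 0) : Sim l x 1 ∨ Sim l (-x) 1 := by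
  have hadd : ∀ w, Sim l w 1 → Sim l (1 + w) 1 ∨ Sim l (-(1 + w)) 1 := by
    intro w hw
    rcases H.sim_one_add_cases h1 h2 hw with h | h | h
    · exact Or.inl h
    · exact Or.inr h
    · exact absurd h (hD w hw)
  have hsub : ∀ w, Sim l w 1 → w ≠ 1 → Sim l (1 - w) 1 ∨ Sim l (-(1 - w)) 1 := by
    intro w hw hne
    by_contra hcon
    refine hne (H.eq_one_of_neg_sub h1 h2 hw fun u hu hv => ?_)
    rcases hadd u hu with h | h
    · exfalso
      have h0 := H.ne_zero_of_sim h one_ne_zero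
      have e : 1 - w = (1 + u) * (1 + (-w - u) / (1 + u)) := by field_simp; ring
      have hk : Sim l ((-w - u) / (1 + u)) 1 := by
        rw [div_eq_mul_inv]
        exact H.sim_one_mul hv (H.sim_one_inv h)
      apply hcon
      rw [e, ← mul_neg]
      rcases hadd _ hk with h' | h'
      · exact Or.inl (H.sim_one_mul h h')
      · exact Or.inr (H.sim_one_mul h h')
    · convert h using 1
      ring
  have hn : ∀ n : ℕ, (n : ZMod p) = 0 ∨ Sim l (n : ZMod p) 1 ∨ Sim l (-(n : ZMod p)) 1 := by
    intro n
    induction n with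
    | zero => simp
    | succ n ih =>
      push_cast
      rcases ih with h | h | h
      · rw [h, zero_add]
        exact Or.inr (Or.inl ⟨rfl, rfl⟩)
      · rw [add_comm]
        exact Or.inr (hadd _ h)
      · by_cases hne : -(n : ZMod p) = 1
        · left
          rw [← hne, add_neg_cancel]
        · have := hsub _ h hne
          rw [sub_neg_eq_add, add_comm] at this
          exact Or.inr this
  have := hn x.val
  rw [ZMod.natCast_zmod_val] at this
  exact this.resolve_left hx

/-- Squares of elements of `K ∪ -K` lie in `K`, so `K` contains all nonzero squares. As `-1 ∉ K`, it
is a nonsquare; the inverse of a nonsquare generator would be a square, hence a generator. -/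
theorem paley_of_forall (hD : ∀ w, Sim l w 1 → ¬ (l (1 + w) = 2 ∧ l (-(1 + w)) = 3)) :
    p % 4 = 3 ∧ ∀ x, l x = 1 ↔ x ≠ 0 ∧ IsSquare x := by
  have hall := fun x hx => H.sim_one_or_neg h1 h2 hD (x := x) hx
  have hsq : ∀ x, x ≠ 0 → IsSquare x → Sim l x 1 := by
    rintro x hx ⟨y, rfl⟩
    have hy : y ≠ 0 := by
      rintro rfl
      simp at hx
    rcases hall y hy with h | h
    · exact H.sim_one_mul h h
    · simpa using H.sim_one_mul h h
  have hneg : ¬ IsSquare (-1 : ZMod p) := by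
    intro h
    have := (hsq _ (neg_ne_zero.2 one_ne_zero) h).1
    omega
  refine ⟨by simpa using mt ZMod.exists_sq_eq_neg_one_iff.2 hneg, fun x => ⟨fun hx => ?_, ?_⟩⟩
  · have hx0 : x ≠ 0 := by
      rintro rfl
      rw [H.zero] at hx
      omega
    refine ⟨hx0, ?_⟩
    by_contra hns
    have h3 := hsq _ (neg_ne_zero.2 hx0) (by
      rw [neg_eq_neg_one_mul]
      exact isSquare_mul_of_not_isSquare hneg hns)
    have h4 := H.two_le_neg hx
    have h5 := h3.1
    omega
  · rintro ⟨hx0, hx⟩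
    exact (hsq x hx0 hx).1.trans h1

omit h1 h2 in
/-- The elements with the same two-way length as `1` satisfy `x ^ k = 1`, where `k` is their
number, and `k` is odd. -/
theorem odd_card_and_pow_eq_one :
    Odd (Finset.univ.filter fun x => Sim l x 1).card ∧
      ∀ x, Sim l x 1 → x ^ (Finset.univ.filter fun x => Sim l x 1).card = 1 := by
  let K : Subgroup (ZMod p)ˣ :=
    { carrier := {u | Sim l (u : ZMod p) 1}
      mul_mem' := fun {x y} hx hy => by
        simp only [Set.mem_ofPred_eq, Units.val_mul] at *
        exact H.sim_one_mul hx hy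
      one_mem' := ⟨rfl, rfl⟩
      inv_mem' := fun {x} hx => by
        simp only [Set.mem_ofPred_eq, Units.val_inv_eq_inv_val] at *
        exact H.sim_one_inv hx }
  have hmem : ∀ u : (ZMod p)ˣ, u ∈ K ↔ Sim l (u : ZMod p) 1 := fun u => Iff.rfl
  have hcard : Nat.card K = (Finset.univ.filter fun x => Sim l x 1).card := by
    rw [← Fintype.card_subtype, ← Nat.card_eq_fintype_card]
    exact Nat.card_congr
      { toFun := fun u => ⟨((u : (ZMod p)ˣ) : ZMod p), u.2⟩
        invFun := fun x => ⟨Units.mk0 x.1 (H.ne_zero_of_sim x.2 one_ne_zero), x.2⟩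
        left_inv := fun u => by ext; simp
        right_inv := fun x => by ext; simp }
  constructor
  -- An element of order two could only be `-1`, which is not in the class of `1`.
  · by_contra hodd
    rw [Nat.not_odd_iff_even, even_iff_two_dvd, ← hcard] at hodd
    obtain ⟨x, hx⟩ := exists_prime_orderOf_dvd_card' 2 hodd
    have hx1 : ((x : (ZMod p)ˣ) : ZMod p) ≠ 1 := by
      intro h
      rw [Units.val_eq_one, OneMemClass.coe_eq_one] at h
      rw [h, orderOf_one] at hx
      omega
    have hx2 : ((x : (ZMod p)ˣ) : ZMod p) ^ 2 = 1 := by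
      have := pow_orderOf_eq_one x
      rw [hx] at this
      have := congrArg (fun y : K => ((y : (ZMod p)ˣ) : ZMod p)) this
      simpa using this
    have h3 : ((x : (ZMod p)ˣ) : ZMod p) = -1 := (sq_eq_one_iff.1 hx2).resolve_left hx1
    have h4 := (hmem x).1 x.2
    rw [h3] at h4
    exact H.length_ne_neg one_ne_zero h4.1.symm
  · intro x hx
    have hx0 := H.ne_zero_of_sim hx one_ne_zero
    have := pow_card_eq_one' (x := (⟨Units.mk0 x hx0, hx⟩ : K))
    rw [hcard] at this
    have := congrArg (fun y : K => ((y : (ZMod p)ˣ) : ZMod p)) this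
    simpa using this

end GirthThree

end IsCyclotomicLength

end CyclotomicLength

/-! ### A class of type `(2,3)` in `1 + K`: cyclotomic numbers -/

namespace CyclotomicLength

variable {p : ℕ} [Fact p.Prime] {l : ZMod p → ℕ}

/-- The cyclotomic numbers: the number of `w` similar to `1` with `1 + x w` similar to `y`. -/
def cycNum (l : ZMod p → ℕ) (x y : ZMod p) : ℕ :=
  (Finset.univ.filter fun w => Sim l w 1 ∧ Sim l (1 + x * w) y).card

namespace IsCyclotomicLength

variable (H : IsCyclotomicLength l)
include H

theorem sim_neg {x y : ZMod p} (h : Sim l x y) : Sim l (-x) (-y) := by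
  have := H.mul_sim (-1) x y (neg_ne_zero.2 one_ne_zero) h
  simpa using this

/-- With `t = -1 - s ∈ K`, the difference `u - s` lies in `dK` or `-dK`, and `t = -d + (u - s) =
-d(1 ∓ k)` with `k ∈ K`. Since `±d ∉ K`, the factor `1 ∓ k` is in `±dK`, so one of `±d²` is in `K`;
`d²` is not. -/
theorem sim_neg_mul_self {d s u : ZMod p} (h1 : l 1 = 1) (h2 : l (-1) = 2)
    (hd : l d = 2 ∧ l (-d) = 3) (hdu : d = 1 + u) (hu : Sim l u 1) (hs : Sim l s 1)
    (hs' : Sim l (-1 - s) 1) : Sim l (-(d * d)) 1 := by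
  have hd0 : d ≠ 0 := by
    rintro rfl
    rw [H.zero] at hd
    omega
  have hu0 := H.ne_zero_of_sim hu one_ne_zero
  have hs0 := H.ne_zero_of_sim hs one_ne_zero
  have ht := (sim_one_iff h1 h2 _).1 hs'
  -- With `|K| = 2j + 1`, `d² ∈ K` gives `(d · (d²)^j)² = 1`, so `d` or `-d` is the inverse of
  -- `(d²)^j ∈ K`.
  have hdd : ¬ Sim l (d * d) 1 := by
    intro h
    obtain ⟨⟨j, hj⟩, hpow⟩ := H.odd_card_and_pow_eq_one
    have e1 := hpow _ h
    have hjK : ∀ i : ℕ, Sim l ((d * d) ^ i) 1 := by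
      intro i
      induction i with
      | zero => exact ⟨by simp, by simp⟩
      | succ i ih => rw [pow_succ]; exact H.sim_one_mul ih h
    have e2 := H.sim_one_inv (hjK j)
    rw [hj, ← sq, ← pow_mul, mul_comm, pow_mul, sq_eq_one_iff] at e1
    have hpj : (d * d) ^ j ≠ 0 := pow_ne_zero _ (mul_ne_zero hd0 hd0)
    rcases e1 with e1 | e1
    · have : d = ((d * d) ^ j)⁻¹ := by
        field_simp
        rw [← e1]
        ring
      rw [← this] at e2
      have := e2.1
      omega
    · have : -d = ((d * d) ^ j)⁻¹ := by
        field_simp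
        rw [← neg_eq_iff_eq_neg.2 e1]
        ring
      rw [← this] at e2
      have := e2.1
      omega
  have hsu : Sim l (s / u) 1 := by
    rw [div_eq_mul_inv]
    exact H.sim_one_mul hs (H.sim_one_inv hu)
  have hsu1 : s / u ≠ 1 := by
    intro h
    rw [div_eq_one_iff_eq hu0] at h
    rw [h, show -1 - u = -d by rw [hdu]; ring] at ht
    omega
  have hus0 : 1 - s / u ≠ 0 := sub_ne_zero.2 hsu1.symm
  have hy : Sim l (u - s) (1 - s / u) := by
    have := H.sim_mul_of_sim_one hu hus0
    rwa [sub_mul, one_mul, div_mul_cancel₀ _ hu0] at this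
  -- neither `u - s` nor `s - u` is the negative of a generator
  have e1 : 2 ≤ l (-(u - s)) := by
    have := H.add_le (-(u - s)) (-1 - s)
    rw [show -(u - s) + (-1 - s) = -d by rw [hdu]; ring] at this
    omega
  have e2 : 2 ≤ l (u - s) := by
    have hd' : Sim l (1 + u⁻¹) d := by
      have := H.sim_div_of_sim_one hu hd0
      rwa [show d / u = 1 + u⁻¹ by rw [hdu]; field_simp; ring] at this
    have e3 := H.add_le (-(u⁻¹ - s⁻¹)) (-1 - s⁻¹)
    rw [show -(u⁻¹ - s⁻¹) + (-1 - s⁻¹) = -(1 + u⁻¹) by ring, hd'.2] at e3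
    have e4 := ((sim_one_iff h1 h2 _).1 (H.sim_one_neg_one_sub_inv hs hs')).1
    have e5 := H.sim_div_of_sim_one hs hus0
    rw [show (1 - s / u) / s = -(u⁻¹ - s⁻¹) by field_simp; ring] at e5
    have e6 := (hy.trans e5.symm).1
    omega
  have hcase : (l (u - s) = 2 ∧ l (-(u - s)) = 3) ∨ (l (u - s) = 3 ∧ l (-(u - s)) = 2) := by
    have := H.sim_one_sub_cases h1 h2 hsu hsu1
    rw [sim_one_iff h1 h2, sim_one_iff h1 h2, neg_neg, ← hy.1, ← hy.2] at this
    omega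
  rcases hcase with hc | hc
  · have hyd : Sim l (u - s) d := ⟨hc.1.trans hd.1.symm, hc.2.trans hd.2.symm⟩
    have hk := H.sim_one_div hd0 hyd
    have het : -1 - s = -d * (1 - (u - s) / d) := by
      field_simp
      rw [hdu]
      ring
    have hk1 : (u - s) / d ≠ 1 := by
      intro h
      rw [h, sub_self, mul_zero] at het
      rw [het, H.zero] at ht
      omega
    rcases H.sim_one_sub_cases h1 h2 hk hk1 with h | h | h | h
    · have := (H.sim_mul_of_sim_one h (neg_ne_zero.2 hd0)).1
      rw [← het] at this
      omega
    · have := (H.sim_mul_of_sim_one h hd0).1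
      rw [show d * -(1 - (u - s) / d) = -1 - s by rw [het]; ring] at this
      omega
    · have h' : Sim l (1 - (u - s) / d) d := ⟨h.1.trans hd.1.symm, h.2.trans hd.2.symm⟩
      have := H.mul_sim (-d) _ _ (neg_ne_zero.2 hd0) h'
      rw [← het, neg_mul] at this
      exact this.symm.trans hs'
    · exfalso
      have h' : Sim l (1 - (u - s) / d) (-d) :=
        ⟨h.1.trans hd.2.symm, h.2.trans (by rw [neg_neg]; exact hd.1.symm)⟩
      have := H.mul_sim (-d) _ _ (neg_ne_zero.2 hd0) h'
      rw [← het, neg_mul_neg] at this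
      exact hdd (this.symm.trans hs')
  · have hyd : Sim l (-(u - s)) d := ⟨hc.2.trans hd.1.symm, by
      rw [neg_neg]; exact hc.1.trans hd.2.symm⟩
    have hk := H.sim_one_div hd0 hyd
    have het : -1 - s = -d * (1 + -(u - s) / d) := by
      field_simp
      rw [hdu]
      ring
    rcases H.sim_one_add_cases h1 h2 hk with h | h | h
    · exfalso
      have := (H.sim_mul_of_sim_one h (neg_ne_zero.2 hd0)).1
      rw [← het] at this
      omega
    · exfalso
      have := (H.sim_mul_of_sim_one h hd0).1
      rw [show d * -(1 + -(u - s) / d) = -1 - s by rw [het]; ring] at this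
      omega
    · have h' : Sim l (1 + -(u - s) / d) d := ⟨h.1.trans hd.1.symm, h.2.trans hd.2.symm⟩
      have := H.mul_sim (-d) _ _ (neg_ne_zero.2 hd0) h'
      rw [← het, neg_mul] at this
      exact this.symm.trans hs'

/-- A solution of `1 + xw = yv` with `w, v ∈ K` is a solution of `1 - yv = -xw`. -/
theorem cycNum_swap_le {x y : ZMod p} (hx : x ≠ 0) (hy : y ≠ 0) :
    cycNum l x y ≤ cycNum l (-y) (-x) := by
  apply Finset.card_le_card_of_injOn (fun w => (1 + x * w) / y)
  · intro w
    simp only [Finset.coe_filter, Finset.mem_univ, true_and, Set.mem_ofPred_eq]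
    rintro ⟨hw, hw'⟩
    refine ⟨H.sim_one_div hy hw', ?_⟩
    rw [show 1 + -y * ((1 + x * w) / y) = -x * w by field_simp; ring]
    exact H.sim_mul_of_sim_one hw (neg_ne_zero.2 hx)
  · intro w _ v _ h
    have h' := (div_left_inj' hy).1 h
    exact mul_left_cancel₀ hx (add_left_cancel h')

theorem cycNum_swap {x y : ZMod p} (hx : x ≠ 0) (hy : y ≠ 0) :
    cycNum l x y = cycNum l (-y) (-x) := by
  refine le_antisymm (H.cycNum_swap_le hx hy) ?_
  have := H.cycNum_swap_le (neg_ne_zero.2 hy) (neg_ne_zero.2 hx)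
  rwa [neg_neg, neg_neg] at this

/-- Divide `1 + xw = yv` by `xw`. -/
theorem cycNum_inv_le {x y : ZMod p} (hx : x ≠ 0) (hy : y ≠ 0) :
    cycNum l x y ≤ cycNum l x⁻¹ (y / x) := by
  apply Finset.card_le_card_of_injOn (fun w => w⁻¹)
  · intro w
    simp only [Finset.coe_filter, Finset.mem_univ, true_and, Set.mem_ofPred_eq]
    rintro ⟨hw, hw'⟩
    refine ⟨H.sim_one_inv hw, ?_⟩
    have hw0 := H.ne_zero_of_sim hw one_ne_zero
    have e1 := H.mul_sim (x⁻¹ * w⁻¹) _ _ (mul_ne_zero (inv_ne_zero hx) (inv_ne_zero hw0)) hw'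
    rw [show x⁻¹ * w⁻¹ * (1 + x * w) = 1 + x⁻¹ * w⁻¹ by field_simp; ring,
      show x⁻¹ * w⁻¹ * y = y / x * w⁻¹ by field_simp] at e1
    exact e1.trans (H.sim_mul_of_sim_one (H.sim_one_inv hw) (div_ne_zero hy hx))
  · intro w _ v _ h
    exact inv_injective h

theorem cycNum_inv {x y : ZMod p} (hx : x ≠ 0) (hy : y ≠ 0) :
    cycNum l x y = cycNum l x⁻¹ (y / x) := by
  refine le_antisymm (H.cycNum_inv_le hx hy) ?_
  have := H.cycNum_inv_le (inv_ne_zero hx) (div_ne_zero hy hx)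
  rwa [inv_inv, div_inv_eq_mul, div_mul_cancel₀ _ hx] at this

/-- The number of representations of `y` up to similarity as `x + ε w`. -/
theorem card_add_mul {x ε y z t : ZMod p} (hx : x ≠ 0) (hz : z ≠ 0)
    (hz' : Sim l (ε / x) z) (ht : Sim l (y / x) t) :
    (Finset.univ.filter fun w => Sim l w 1 ∧ Sim l (x + ε * w) y).card = cycNum l z t := by
  have hε : ε / x ≠ 0 := H.ne_zero_of_sim hz' hz
  have hε0 : ε ≠ 0 := fun h => hε (by rw [h, zero_div])
  have hk : Sim l (ε / x / z) 1 := H.sim_one_div hz hz'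
  have hk0 := H.ne_zero_of_sim hk one_ne_zero
  have key : ∀ w, Sim l (x + ε * w) y ↔ Sim l (1 + z * (ε / x / z * w)) t := by
    intro w
    have e : 1 + z * (ε / x / z * w) = x⁻¹ * (x + ε * w) := by field_simp
    rw [e]
    constructor
    · intro h
      have := H.mul_sim x⁻¹ _ _ (inv_ne_zero hx) h
      rw [show x⁻¹ * y = y / x by rw [div_eq_mul_inv, mul_comm]] at this
      exact this.trans ht
    · intro h
      have := H.mul_sim x _ _ hx (h.trans ht.symm)
      rwa [mul_inv_cancel_left₀ hx, mul_div_cancel₀ _ hx] at this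
  apply le_antisymm
  · apply Finset.card_le_card_of_injOn (fun w => ε / x / z * w)
    · intro w
      simp only [Finset.coe_filter, Finset.mem_univ, true_and, Set.mem_ofPred_eq]
      exact fun h => ⟨H.sim_one_mul hk h.1, (key w).1 h.2⟩
    · exact fun u _ v _ h => mul_left_cancel₀ hk0 h
  · apply Finset.card_le_card_of_injOn (fun w => (ε / x / z)⁻¹ * w)
    · intro w
      simp only [Finset.coe_filter, Finset.mem_univ, true_and, Set.mem_ofPred_eq]
      refine fun h => ⟨H.sim_one_mul (H.sim_one_inv hk) h.1, (key _).2 ?_⟩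
      rw [mul_inv_cancel_left₀ hk0]
      exact h.2
    · exact fun u _ v _ h => mul_left_cancel₀ (inv_ne_zero hk0) h

end IsCyclotomicLength

end CyclotomicLength

namespace CyclotomicLength

variable {p : ℕ} [Fact p.Prime] {l : ZMod p → ℕ}

namespace IsCyclotomicLength

variable (H : IsCyclotomicLength l)
include H

omit H in
theorem sum_ite_sim (x y : ZMod p) (A : ℕ) :
    (∑ w ∈ Finset.univ.filter fun w => Sim l w 1, if Sim l (1 + x * w) y then A else 0) =
      cycNum l x y * A := by
  rw [← Finset.sum_filter, Finset.filter_filter, Finset.sum_const, smul_eq_mul, cycNum]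

section GirthThree

variable {d : ZMod p} (h1 : l 1 = 1) (h2 : l (-1) = 2) (hd : l d = 2 ∧ l (-d) = 3)
include h1 h2 hd

theorem sum_one_add (g : ZMod p → ℕ) (A B C : ℕ)
    (hA : ∀ w, Sim l w 1 → Sim l (1 + w) 1 → g w = A)
    (hB : ∀ w, Sim l w 1 → Sim l (1 + w) (-1) → g w = B)
    (hC : ∀ w, Sim l w 1 → Sim l (1 + w) d → g w = C) :
    ∑ w ∈ Finset.univ.filter (fun w => Sim l w 1), g w =
      cycNum l 1 1 * A + cycNum l 1 (-1) * B + cycNum l 1 d * C := by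
  rw [← sum_ite_sim, ← sum_ite_sim, ← sum_ite_sim, ← Finset.sum_add_distrib,
    ← Finset.sum_add_distrib]
  apply Finset.sum_congr rfl
  intro w hw
  simp only [Finset.mem_filter, Finset.mem_univ, true_and] at hw
  rw [one_mul]
  have hc := H.sim_one_add_cases h1 h2 hw
  have hA := hA w hw
  have hB := hB w hw
  have hC := hC w hw
  generalize 1 + w = x at *
  simp only [Sim, neg_neg, h1, h2, hd.1, hd.2] at *
  rcases hc with hc | hc | hc
  · rw [hA hc]
    simp [hc]
  · rw [hB ⟨hc.2, hc.1⟩]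
    simp [hc]
  · rw [hC hc]
    simp [hc]

/-- The term `g 1` stands apart because `1 - w = 0` at `w = 1`. -/
theorem sum_one_sub (g : ZMod p → ℕ) (A B C D : ℕ)
    (hA : ∀ w, Sim l w 1 → Sim l (1 + -w) 1 → g w = A)
    (hB : ∀ w, Sim l w 1 → Sim l (1 + -w) (-1) → g w = B)
    (hC : ∀ w, Sim l w 1 → Sim l (1 + -w) d → g w = C)
    (hD : ∀ w, Sim l w 1 → Sim l (1 + -w) (-d) → g w = D) :
    ∑ w ∈ Finset.univ.filter (fun w => Sim l w 1), g w =
      g 1 + cycNum l (-1) 1 * A + cycNum l (-1) (-1) * B + cycNum l (-1) d * C +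
        cycNum l (-1) (-d) * D := by
  have hg : g 1 = ∑ w ∈ Finset.univ.filter (fun w => Sim l w 1), if w = 1 then g 1 else 0 := by
    rw [Finset.sum_ite_eq', if_pos (Finset.mem_filter.2 ⟨Finset.mem_univ _, rfl, rfl⟩)]
  conv_rhs => rw [hg]
  rw [← sum_ite_sim, ← sum_ite_sim, ← sum_ite_sim, ← sum_ite_sim, ← Finset.sum_add_distrib,
    ← Finset.sum_add_distrib, ← Finset.sum_add_distrib, ← Finset.sum_add_distrib]
  apply Finset.sum_congr rfl
  intro w hw
  simp only [Finset.mem_filter, Finset.mem_univ, true_and] at hw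
  rw [neg_one_mul]
  by_cases hw1 : w = 1
  · subst hw1
    simp [Sim, H.zero, h1, h2, hd]
  have hc := H.sim_one_sub_cases h1 h2 hw hw1
  have hA := hA w hw
  have hB := hB w hw
  have hC := hC w hw
  have hD := hD w hw
  rw [if_neg hw1]
  rw [sub_eq_add_neg] at hc
  generalize 1 + -w = x at *
  simp only [Sim, neg_neg, h1, h2, hd.1, hd.2] at *
  rcases hc with hc | hc | hc | hc
  · rw [hA hc]
    simp [hc]
  · rw [hB ⟨hc.2, hc.1⟩]
    simp [hc]
  · rw [hC hc]
    simp [hc]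
  · rw [hD hc]
    simp [hc]


omit H h1 h2 hd in
-- Pairs `(w, u)` in `K × K` with `1 + w - u` in the class of `y`, counted by `w` and by `u`. This
-- double count is the source of the quadratic relations.
theorem sum_card_comm (y : ZMod p) :
    ∑ w ∈ Finset.univ.filter (fun w => Sim l w 1),
        (Finset.univ.filter fun u => Sim l u 1 ∧ Sim l (1 + w + -1 * u) y).card =
      ∑ u ∈ Finset.univ.filter (fun u => Sim l u 1),
        (Finset.univ.filter fun w => Sim l w 1 ∧ Sim l (1 + -u + 1 * w) y).card := by
  simp only [← Finset.filter_filter, Finset.card_filter _ (Finset.filter _ _)]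
  rw [Finset.sum_comm]
  refine Finset.sum_congr rfl fun u _ => Finset.sum_congr rfl fun w _ => ?_
  rw [show 1 + w + -1 * u = 1 + -u + 1 * w by ring]

omit h1 h2 hd in
theorem sim_div_left {a x y : ZMod p} (ha : a ≠ 0) (hy : y ≠ 0) (h : Sim l x y) :
    Sim l (a / x) (a / y) := by
  have hx := H.ne_zero_of_sim h hy
  have := H.mul_sim (a / (x * y)) _ _ (div_ne_zero ha (mul_ne_zero hx hy)) h.symm
  rwa [show a / (x * y) * y = a / x by field_simp, show a / (x * y) * x = a / y by field_simp]
    at this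

/-- The relations between the cyclotomic numbers of the four classes `±1`, `±d`. -/
theorem cycNum_relations (hsq : Sim l (-(d * d)) 1) (hd' : ∀ w, Sim l w 1 → ¬ Sim l (1 + w) (-d)) :
    (Finset.univ.filter fun w => Sim l w 1).card =
        cycNum l 1 1 + cycNum l 1 (-1) + cycNum l 1 d ∧
      (Finset.univ.filter fun w => Sim l w 1).card =
        1 + 2 * cycNum l 1 1 + 2 * cycNum l (-1) d ∧
      cycNum l 1 d * cycNum l (-1) d =
        cycNum l 1 1 * cycNum l 1 d + cycNum l (-1) d * cycNum l (-1) d ∧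
      cycNum l 1 (-1) * cycNum l 1 d =
        cycNum l (-1) d * cycNum l 1 d + cycNum l (-1) d * cycNum l (-1) d := by
  have hd0 : d ≠ 0 := by
    rintro rfl
    rw [H.zero] at hd
    omega
  have o : (1 : ZMod p) ≠ 0 := one_ne_zero
  have o' : (-1 : ZMod p) ≠ 0 := neg_ne_zero.2 o
  have hdn : -d ≠ 0 := neg_ne_zero.2 hd0
  -- Modulo `K` one has `d² = -1`, so `±1, ±d` form a cyclic group of order four. All cyclotomic
  -- numbers below thereby reduce to four unknowns and `0`.
  have i1 : Sim l (1 / d) (-d) := by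
    have := H.sim_mul_of_sim_one hsq (div_ne_zero o hd0)
    rw [show 1 / d * -(d * d) = -d by field_simp] at this
    exact this.symm
  have i2 : Sim l (-1 / d) d := by
    have := H.sim_neg i1
    rwa [neg_neg, ← neg_div] at this
  -- the values of the cyclotomic numbers
  have z0 : cycNum l 1 (-d) = 0 := by
    rw [cycNum, Finset.card_eq_zero, Finset.filter_eq_empty_iff]
    rintro w - ⟨hw, hw'⟩
    rw [one_mul] at hw'
    exact hd' w hw hw'
  have a1 : cycNum l (-1) (-1) = cycNum l 1 1 := (H.cycNum_swap o o).symm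
  have a2 : cycNum l (-1) 1 = cycNum l 1 1 := by
    rw [H.cycNum_inv o' o, inv_neg, inv_one, div_neg, div_one, a1]
  have f1 : cycNum l (-1) (-d) = cycNum l (-1) d := by
    rw [H.cycNum_inv o' hdn, inv_neg, inv_one, neg_div_neg_eq, div_one]
  have f2 : cycNum l d 1 = cycNum l (-1) d := by rw [H.cycNum_swap hd0 o, f1]
  have f3 : cycNum l (-d) 1 = cycNum l (-1) d := by rw [H.cycNum_swap hdn o, neg_neg]
  have z1 : cycNum l d (-1) = 0 := by rw [H.cycNum_swap hd0 o', neg_neg, z0]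
  have e1 : cycNum l (-d) (-1) = cycNum l 1 d := by
    rw [H.cycNum_swap hdn o', neg_neg, neg_neg]
  -- representations as `x ± w` up to similarity
  have rep : ∀ ε x y z t c, ε ≠ 0 → y ≠ 0 → c ≠ 0 → z ≠ 0 → Sim l x c → Sim l (ε / c) z →
      Sim l (y / c) t →
      (Finset.univ.filter fun w => Sim l w 1 ∧ Sim l (x + ε * w) y).card = cycNum l z t := by
    intro ε x y z t c hε hy hc hz hx h h'
    exact H.card_add_mul (H.ne_zero_of_sim hx hc) hz ((H.sim_div_left hε hc hx).trans h)
      ((H.sim_div_left hy hc hx).trans h')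
  have rfl' : ∀ x y : ZMod p, x = y → Sim l x y := by
    rintro x _ rfl
    exact ⟨rfl, rfl⟩
  have r1 : ∀ y, y ≠ 0 → (l y ≠ 1) →
      (Finset.univ.filter fun w => Sim l w 1 ∧ Sim l (1 + -1 + 1 * w) y).card = 0 := by
    intro y hy0 hy
    rw [Finset.card_eq_zero, Finset.filter_eq_empty_iff]
    rintro w - ⟨hw, hw'⟩
    rw [add_neg_cancel, zero_add, one_mul] at hw'
    have := hw.1
    have := hw'.1
    omega
  refine ⟨?_, ?_, ?_, ?_⟩
  · have := H.sum_one_add h1 h2 hd (fun _ => 1) 1 1 1 (fun _ _ _ => rfl) (fun _ _ _ => rfl)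
      (fun _ _ _ => rfl)
    simpa using this
  · have := H.sum_one_sub h1 h2 hd (fun _ => 1) 1 1 1 1 (fun _ _ _ => rfl) (fun _ _ _ => rfl)
      (fun _ _ _ => rfl) (fun _ _ _ => rfl)
    rw [← Finset.card_eq_sum_ones, a1, a2, f1] at this
    rw [this]
    ring
  · have hc := sum_card_comm (l := l) d
    rw [H.sum_one_add h1 h2 hd _ (cycNum l (-1) d) 0 (cycNum l (-1) d),
      H.sum_one_sub h1 h2 hd _ (cycNum l 1 d) (cycNum l (-1) d) (cycNum l (-1) d) 0,
      r1 d hd0 (by omega), a1, a2, f1] at hc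
    · linarith
    · exact fun w _ h => rep 1 _ d 1 d 1 o hd0 o o h (rfl' _ _ (by simp)) (rfl' _ _ (by simp))
    · exact fun w _ h => (rep 1 _ d (-1) (-d) (-1) o hd0 o' o' h (rfl' _ _ (by simp))
        (rfl' _ _ (by simp [div_neg]))).trans f1
    · exact fun w _ h => (rep 1 _ d (-d) 1 d o hd0 hd0 hdn h i1 (rfl' _ _ (by simp [hd0]))).trans f3
    · exact fun w _ h => (rep 1 _ d d (-1) (-d) o hd0 hdn hd0 h
        (by rw [div_neg, ← neg_div]; exact i2)
        (rfl' _ _ (by rw [div_neg, div_self hd0]))).trans z1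
    · exact fun w _ h => rep (-1) _ d (-1) d 1 o' hd0 o o' h (rfl' _ _ (by simp))
        (rfl' _ _ (by simp))
    · exact fun w _ h => (rep (-1) _ d 1 (-d) (-1) o' hd0 o' o h (rfl' _ _ (by simp))
        (rfl' _ _ (by simp [div_neg]))).trans z0
    · exact fun w _ h => (rep (-1) _ d d 1 d o' hd0 hd0 hd0 h i2
        (rfl' _ _ (by simp [hd0]))).trans f2
  · have hc := sum_card_comm (l := l) (-d)
    rw [H.sum_one_add h1 h2 hd _ (cycNum l (-1) d) (cycNum l 1 d) 0,
      H.sum_one_sub h1 h2 hd _ 0 (cycNum l (-1) d) (cycNum l 1 d) (cycNum l (-1) d),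
      r1 (-d) hdn (by omega), a1, a2, f1] at hc
    · linarith
    · exact fun w _ h => (rep 1 _ (-d) 1 (-d) 1 o hdn o o h (rfl' _ _ (by simp))
        (rfl' _ _ (by simp))).trans z0
    · exact fun w _ h => rep 1 _ (-d) (-1) d (-1) o hdn o' o' h (rfl' _ _ (by simp))
        (rfl' _ _ (by simp [div_neg]))
    · exact fun w _ h => (rep 1 _ (-d) (-d) (-1) d o hdn hd0 hdn h i1
        (rfl' _ _ (by rw [neg_div, div_self hd0]))).trans e1
    · exact fun w _ h => (rep 1 _ (-d) d 1 (-d) o hdn hdn hd0 h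
        (by rw [div_neg, ← neg_div]; exact i2) (rfl' _ _ (by rw [div_self hdn]))).trans f2
    · exact fun w _ h => (rep (-1) _ (-d) (-1) (-d) 1 o' hdn o o' h (rfl' _ _ (by simp))
        (rfl' _ _ (by simp))).trans f1
    · exact fun w _ h => rep (-1) _ (-d) 1 d (-1) o' hdn o' o h (rfl' _ _ (by simp))
        (rfl' _ _ (by simp [div_neg]))
    · exact fun w _ h => (rep (-1) _ (-d) d (-1) d o' hdn hd0 hd0 h i2
        (rfl' _ _ (by rw [neg_div, div_self hd0]))).trans z1

end GirthThree

end IsCyclotomicLength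

end CyclotomicLength

/-! ### Solving the relations, the exceptional prime, and the classification -/

namespace CyclotomicLength

variable {p : ℕ} [Fact p.Prime] {l : ZMod p → ℕ}

/-- Eliminating `f²` gives `a + b = 2f`, hence `e = 2a + 1`. Then `(e - f)(e - f - 1) + f(f - 1) =
0` with both terms nonnegative, so `f = 1`, and `e`, being odd, is `1`. -/
theorem eq_of_cycNum_relations {a b e f k : ℕ} (h1 : k = a + b + e) (h2 : k = 1 + 2 * a + 2 * f)
    (h3 : e * f = a * e + f * f) (h4 : b * e = f * e + f * f) (hb : b ≠ 0) (he : e ≠ 0) :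
    e = 1 ∧ k = 3 := by
  have hab : a + b = 2 * f := by
    have : e * (a + b) = e * (2 * f) := by linarith
    exact Nat.eq_of_mul_eq_mul_left (Nat.pos_of_ne_zero he) this
  have he' : e = 2 * a + 1 := by omega
  have hf : f ≠ 0 := by
    rintro rfl
    have := mul_ne_zero hb he
    omega
  have hf1 : f = 1 := by
    by_contra hne
    have hf2 : 2 ≤ f := by omega
    zify at h3 he' hf2
    have h5 : ((e : ℤ) - f) * (e - f - 1) + f * (f - 1) = 0 := by
      have : (2 * a : ℤ) = e - 1 := by linarith
      nlinarith
    have h6 : 0 ≤ ((e : ℤ) - f) * (e - f - 1) := by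
      rcases le_or_gt ((e : ℤ) - f) 0 with h | h
      · nlinarith
      · nlinarith
    nlinarith
  subst hf1
  have ha : a = 0 := by
    rcases Nat.eq_zero_or_pos a with h | h
    · exact h
    · nlinarith
  omega

theorem card_cube_eq_one_five :
    (Finset.univ.filter fun x : ZMod 5 => x ^ 3 = 1).card = 1 := by
  decide

theorem card_cube_eq_one_thirteen :
    (Finset.univ.filter fun x : ZMod 13 => x ^ 3 = 1).card = 3 := by
  decide

theorem exists_cube_eq_one_thirteen : ∀ x : ZMod 13, x ≠ 0 → ∃ y, y ^ 3 = 1 ∧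
    (x = y ∨ x = -1 * y ∨ x = (1 + 1) * y ∨ x = -(1 + 1) * y) := by
  decide

namespace IsCyclotomicLength

variable (H : IsCyclotomicLength l)
include H

theorem eq_thirteen (h1 : l 1 = 1) (h2 : l (-1) = 2) {u : ZMod p} (hu : Sim l u 1)
    (hd : l (1 + u) = 2 ∧ l (-(1 + u)) = 3) :
    p = 13 ∧ ∀ x, l x = 1 ↔ x ^ 3 = 1 := by
  obtain ⟨s, hs, hs'⟩ := H.exists_add_eq_neg_one h1 h2
  have hsq := H.sim_neg_mul_self h1 h2 hd rfl hu hs hs'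
  have hd' : ∀ w, Sim l w 1 → ¬ Sim l (1 + w) (-(1 + u)) := by
    intro w hw h
    have := H.add_le 1 w
    rw [h.1, hd.2, h1, hw.1, h1] at this
    omega
  have hu' : u ∈ Finset.univ.filter fun w => Sim l w 1 ∧ Sim l (1 + 1 * w) (1 + u) :=
    Finset.mem_filter.2 ⟨Finset.mem_univ _, hu, by rw [one_mul]; exact ⟨rfl, rfl⟩⟩
  obtain ⟨r1, r2, r3, r4⟩ := H.cycNum_relations h1 h2 hd hsq hd'
  obtain ⟨he, hk⟩ := eq_of_cycNum_relations r1 r2 r3 r4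
    (Finset.card_ne_zero_of_mem (a := s) (Finset.mem_filter.2 ⟨Finset.mem_univ _, hs, by
      have := H.sim_neg hs'
      rwa [show -(-1 - s) = 1 + 1 * s by ring] at this⟩))
    (Finset.card_ne_zero_of_mem hu')
  have hu0 := H.ne_zero_of_sim hu one_ne_zero
  have hd0 : 1 + u ≠ 0 := by
    intro h
    rw [h, H.zero] at hd
    omega
  -- By `e = 1`, `u` is the only element of `K` with `1 + u ∈ dK`, and `u⁻¹` has this property too.
  have huinv : u⁻¹ = u := by
    obtain ⟨c, hc⟩ := Finset.card_eq_one.1 he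
    have e1 := hu'
    have e2 : u⁻¹ ∈ Finset.univ.filter fun w => Sim l w 1 ∧ Sim l (1 + 1 * w) (1 + u) := by
      refine Finset.mem_filter.2 ⟨Finset.mem_univ _, H.sim_one_inv hu, ?_⟩
      have := H.sim_div_of_sim_one hu hd0
      rwa [show (1 + u) / u = 1 + 1 * u⁻¹ by field_simp; ring] at this
    rw [hc, Finset.mem_singleton] at e1 e2
    rw [e1]
    rw [e1] at e2
    exact e2
  have hu1 : u = 1 := by
    have : u ^ 2 = 1 := by
      rw [sq]
      nth_rewrite 1 [← huinv]
      exact inv_mul_cancel₀ hu0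
    refine (sq_eq_one_iff.1 this).resolve_right ?_
    rintro rfl
    exact hd0 (by ring)
  subst hu1
  obtain ⟨-, hpow⟩ := H.odd_card_and_pow_eq_one
  rw [hk] at hpow
  -- Now `d = 2`, so `-4 ∈ K`; as `|K| = 3`, `(-4)³ = 1`.
  have h65 : ((65 : ℕ) : ZMod p) = 0 := by
    have := hpow _ hsq
    push_cast
    linear_combination -this
  rw [ZMod.natCast_eq_zero_iff] at h65
  have hp : p.Prime := Fact.out
  have hp' : p = 5 ∨ p = 13 := by
    rw [show 65 = 5 * 13 by norm_num, hp.dvd_mul, Nat.prime_dvd_prime_iff_eq hp (by norm_num),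
      Nat.prime_dvd_prime_iff_eq hp (by norm_num)] at h65
    exact h65
  have hcube : (Finset.univ.filter fun x => Sim l x 1) ⊆
      Finset.univ.filter fun x : ZMod p => x ^ 3 = 1 := by
    intro x
    simp only [Finset.mem_filter, Finset.mem_univ, true_and]
    exact hpow x
  rcases hp' with rfl | rfl
  · exfalso
    have := Finset.card_le_card hcube
    rw [hk] at this
    exact absurd (this.trans card_cube_eq_one_five.le) (by norm_num)
  · refine ⟨rfl, fun x => ?_⟩
    have heq := Finset.eq_of_subset_of_card_le hcube (by rw [hk]; exact card_cube_eq_one_thirteen.le)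
    have hmem : ∀ y : ZMod 13, y ^ 3 = 1 → Sim l y 1 := by
      intro y hy
      have : y ∈ Finset.univ.filter fun x : ZMod 13 => x ^ 3 = 1 := by simpa using hy
      rw [← heq] at this
      simpa using this
    refine ⟨fun hx => ?_, fun hx => (hmem x hx).1.trans h1⟩
    have hx0 : x ≠ 0 := by
      rintro rfl
      rw [H.zero] at hx
      omega
    obtain ⟨y, hy, rfl | rfl | rfl | rfl⟩ := exists_cube_eq_one_thirteen x hx0
    · exact hy
    · have := (H.sim_mul_of_sim_one (hmem y hy) (neg_ne_zero.2 one_ne_zero)).1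
      omega
    · have := (H.sim_mul_of_sim_one (hmem y hy) hd0).1
      omega
    · have := (H.sim_mul_of_sim_one (hmem y hy) (neg_ne_zero.2 hd0)).1
      omega

/-- The generating sets of the cyclotomic word lengths, up to multiplication by a constant. -/
theorem classification :
    ∃ s : ZMod p, s ≠ 0 ∧ ((∀ x, l (s * x) = 1 ↔ x = 1) ∨
      (p % 4 = 3 ∧ ∀ x, l (s * x) = 1 ↔ x ≠ 0 ∧ IsSquare x) ∨
      (p = 13 ∧ ∀ x, l (s * x) = 1 ↔ x ^ 3 = 1)) := by
  -- A generator on a shortest closed walk: minimality of `l (-s)` survives rescaling `s` to `1`.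
  obtain ⟨s, hs, hmin⟩ : ∃ s, l s = 1 ∧ ∀ t, l t = 1 → l (-s) ≤ l (-t) := by
    obtain ⟨s₀, hs₀, -⟩ := H.directed
    obtain ⟨s, hs, hmin⟩ := Finset.exists_min_image (Finset.univ.filter fun s => l s = 1)
      (fun s => l (-s)) ⟨s₀, by simpa using hs₀⟩
    exact ⟨s, by simpa using hs, fun t ht => hmin t (by simpa using ht)⟩
  have hs0 : s ≠ 0 := by
    rintro rfl
    rw [H.zero] at hs
    omega
  have H' := H.rescale hs0
  refine ⟨s, hs0, ?_⟩
  have h1 : l (s * 1) = 1 := by rwa [mul_one]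
  have h2 := H'.two_le_neg h1
  rcases Nat.lt_or_ge 2 (l (s * -1)) with hq | hq
  · left
    refine fun x => ⟨fun hx => ?_, fun hx => by rw [hx, h1]⟩
    refine H'.eq_one_of_three_le ?_ h1 hq x hx
    intro t ht
    have := hmin _ ht
    simpa using this
  · right
    have h2' : l (s * -1) = 2 := le_antisymm hq h2
    by_cases hD : ∀ w, Sim (fun x => l (s * x)) w 1 →
        ¬ (l (s * (1 + w)) = 2 ∧ l (s * -(1 + w)) = 3)
    · exact Or.inl (H'.paley_of_forall h1 h2' hD)
    · push Not at hD
      obtain ⟨u, hu, hd⟩ := hD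
      exact Or.inr (H'.eq_thirteen h1 h2' hu hd)

end IsCyclotomicLength

end CyclotomicLength

/-! ### Schur rings: powers of basic sets and multipliers -/

namespace CyclotomicLength

/-- The two-way length classes of `l` are the basic sets of a Schur ring over `G`. -/
structure IsSchurLength {G : Type*} [AddCommGroup G] [Fintype G] (l : G → ℕ) : Prop where
  eq_zero_iff : ∀ x, l x = 0 ↔ x = 0
  count : ∀ a b z z', Sim l z z' →
    (Finset.univ.filter fun y => Sim l y a ∧ Sim l (z - y) b).card =
      (Finset.univ.filter fun y => Sim l y a ∧ Sim l (z' - y) b).card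

namespace IsSchurLength

variable {G : Type*} [AddCommGroup G] [Fintype G] {l : G → ℕ} (H : IsSchurLength l)
include H

/-- The convolution of two class functions splits over pairs of classes, on which it is a constant
times a structure number; it is again a class function. -/
theorem sum_mul_eq {R : Type*} [CommSemiring R] {f g : G → R}
    (hf : ∀ z z', Sim l z z' → f z = f z') (hg : ∀ z z', Sim l z z' → g z = g z') {z z' : G}
    (hz : Sim l z z') : ∑ y, f y * g (z - y) = ∑ y, f y * g (z' - y) := by
  let t : G → ℕ × ℕ := fun x => (l x, l (-x))
  have ht : ∀ x y, t x = t y ↔ Sim l x y := fun x y => Prod.mk_inj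
  have key : ∀ w, ∑ y, f y * g (w - y) =
      ∑ i ∈ Finset.univ.image t, ∑ j ∈ Finset.univ.image t,
        ∑ y ∈ Finset.univ.filter (fun y => t y = i ∧ t (w - y) = j), f y * g (w - y) := by
    intro w
    rw [← Finset.sum_product', ← Finset.sum_fiberwise_of_maps_to
      (s := Finset.univ) (t := Finset.univ.image t ×ˢ Finset.univ.image t)
      (g := fun y => (t y, t (w - y)))]
    · simp only [Prod.ext_iff]
    · intro y _
      simp
  rw [key, key]
  refine Finset.sum_congr rfl fun i hi => Finset.sum_congr rfl fun j hj => ?_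
  obtain ⟨a, -, rfl⟩ := Finset.mem_image.1 hi
  obtain ⟨b, -, rfl⟩ := Finset.mem_image.1 hj
  have hval : ∀ w, ∑ y ∈ Finset.univ.filter (fun y => t y = t a ∧ t (w - y) = t b),
      f y * g (w - y) =
      (Finset.univ.filter fun y => Sim l y a ∧ Sim l (w - y) b).card • (f a * g b) := by
    intro w
    simp only [ht]
    apply Finset.sum_eq_card_nsmul
    intro y hy
    simp only [Finset.mem_filter, Finset.mem_univ, true_and] at hy
    rw [hf _ _ hy.1, hg _ _ hy.2]
  rw [hval, hval, H.count a b z z' hz]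

theorem coeff_pow_eq {R : Type*} [CommSemiring R] (x : AddMonoidAlgebra R G)
    (hx : ∀ z z', Sim l z z' → x.coeff z = x.coeff z') (n : ℕ) :
    ∀ z z', Sim l z z' → (x ^ n).coeff z = (x ^ n).coeff z' := by
  induction n with
  | zero =>
    intro z z' h
    classical
    have : z = 0 ↔ z' = 0 := by rw [← H.eq_zero_iff, ← H.eq_zero_iff, h.1]
    rw [pow_zero, AddMonoidAlgebra.one_def, AddMonoidAlgebra.coeff_single, Finsupp.single_apply,
      Finsupp.single_apply]
    simp only [eq_comm (a := (0 : G)), this]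
  | succ n ih =>
    intro z z' h
    have hmul : ∀ w, (x ^ n * x).coeff w = ∑ y, (x ^ n).coeff y * x.coeff (w - y) := by
      intro w
      rw [AddMonoidAlgebra.coeff_mul_apply_left, Finsupp.sum_fintype _ _ (by simp)]
      simp only [sub_eq_add_neg, add_comm]
    rw [pow_succ, hmul, hmul]
    exact H.sum_mul_eq ih hx h

/-- Schur's theorem on the `q`-th powers of a basic set. -/
theorem natCast_card_nsmul_eq [DecidableEq G] (q : ℕ) [Fact q.Prime] (c : G) {z z' : G}
    (hz : Sim l z z') :
    ((Finset.univ.filter fun x => Sim l x c ∧ q • x = z).card : ZMod q) =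
      (Finset.univ.filter fun x => Sim l x c ∧ q • x = z').card := by
  have : CharP (AddMonoidAlgebra (ZMod q) G) q :=
    charP_of_injective_algebraMap (algebraMap (ZMod q) (AddMonoidAlgebra (ZMod q) G)).injective q
  let e : AddMonoidAlgebra (ZMod q) G :=
    ∑ x ∈ Finset.univ.filter (fun x => Sim l x c), AddMonoidAlgebra.single x 1
  have he : ∀ w, e.coeff w = if Sim l w c then 1 else 0 := by
    intro w
    simp [e, AddMonoidAlgebra.coeff_sum, AddMonoidAlgebra.coeff_single, Finsupp.finsetSum_apply,
      Finsupp.single_apply]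
  have hpow : ∀ w, (e ^ q).coeff w =
      ((Finset.univ.filter fun x => Sim l x c ∧ q • x = w).card : ZMod q) := by
    intro w
    simp only [e]
    -- Frobenius in characteristic `q`: the `q`-th power of the sum of a class is the sum of the
    -- elements `q • x`.
    rw [sum_pow_char]
    simp only [AddMonoidAlgebra.single_pow, one_pow]
    rw [AddMonoidAlgebra.coeff_sum, Finsupp.finsetSum_apply]
    simp only [AddMonoidAlgebra.coeff_single, Finsupp.single_apply]
    rw [← Finset.sum_filter, Finset.filter_filter, Finset.sum_const, nsmul_eq_mul, mul_one]
  rw [← hpow, ← hpow]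
  refine H.coeff_pow_eq e ?_ q z z' hz
  intro w w' h
  rw [he, he]
  have : Sim l w c ↔ Sim l w' c := ⟨fun h' => h.symm.trans h', fun h' => h.trans h'⟩
  simp only [this]

/-- By injectivity the number in Schur's theorem is `0` or `1`, so congruence modulo `q` is
equality. -/
theorem sim_of_sim_nsmul {q : ℕ} (hq : q.Prime) (hinj : Function.Injective fun x : G => q • x)
    {x y : G} (h : Sim l (q • x) (q • y)) : Sim l x y := by
  classical
  have := Fact.mk hq
  have key : ∀ z, ((Finset.univ.filter fun w => Sim l w y ∧ q • w = q • z).card : ZMod q) =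
      if Sim l z y then 1 else 0 := by
    intro z
    have : (Finset.univ.filter fun w => Sim l w y ∧ q • w = q • z) =
        if Sim l z y then {z} else ∅ := by
      ext w
      have : q • w = q • z ↔ w = z := hinj.eq_iff
      simp only [Finset.mem_filter, Finset.mem_univ, true_and, this]
      split_ifs with hs
      · simp only [Finset.mem_singleton, and_iff_right_iff_imp]
        rintro rfl
        exact hs
      · simp only [Finset.notMem_empty, iff_false, not_and]
        rintro hw rfl
        exact hs hw
    rw [this]
    split_ifs <;> simp
  have := H.natCast_card_nsmul_eq q y h
  rw [key, key, if_pos (show Sim l y y from ⟨rfl, rfl⟩)] at this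
  by_contra hne
  rw [if_neg hne] at this
  exact zero_ne_one this

end IsSchurLength

/-- The basic sets of a Schur ring over a group of prime order are permuted by the
multiplications. -/
theorem IsSchurLength.mul_sim {p : ℕ} [Fact p.Prime] {l : ZMod p → ℕ} (H : IsSchurLength l)
    (c x y : ZMod p) (hc : c ≠ 0) (h : Sim l x y) : Sim l (c * x) (c * y) := by
  have key : ∀ n : ℕ, (n : ZMod p) ≠ 0 → ∀ x y, Sim l (n * x) (n * y) → Sim l x y := by
    intro n
    induction n using Nat.recOnMul with
    | zero => simp
    | one => simp
    | prime q hq =>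
      intro hn x y h
      refine H.sim_of_sim_nsmul hq ?_ (by simpa only [nsmul_eq_mul] using h)
      intro u v huv
      simp only [nsmul_eq_mul] at huv
      exact mul_left_cancel₀ hn huv
    | mul a b iha ihb =>
      intro hn x y h
      push_cast at hn h
      refine ihb (right_ne_zero_of_mul hn) x y (iha (left_ne_zero_of_mul hn) _ _ ?_)
      rwa [← mul_assoc, ← mul_assoc]
  -- The claim `key` cancels natural multipliers, prime by prime; multiplying by `c` is cancelling a
  -- lift of `c⁻¹`.
  apply key c⁻¹.val
  · rw [ZMod.natCast_zmod_val]
    exact inv_ne_zero hc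
  · rwa [ZMod.natCast_zmod_val, inv_mul_cancel_left₀ hc, inv_mul_cancel_left₀ hc]

end CyclotomicLength

/-! ### Primitive Schur rings over cyclic groups of composite order -/

namespace CyclotomicLength

namespace IsSchurLength

section Primitive

variable {G : Type*} [AddCommGroup G] [Fintype G] {l : G → ℕ} (H : IsSchurLength l)
  (hprim : ∀ (K : AddSubgroup G) (x : G), x ≠ 0 → (∀ y, Sim l y x → y ∈ K) → K = ⊤)
include H hprim

/-- No nontrivial translation preserves a nonzero basic set. -/
theorem eq_zero_of_translate {z h : G} (hz : z ≠ 0) (hh : ∀ y, Sim l y z ↔ Sim l (y + h) z) :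
    h = 0 := by
  by_contra hne
  let K : AddSubgroup G :=
    { carrier := {g | ∀ y, Sim l y z ↔ Sim l (y + g) z}
      add_mem' := fun {a b} ha hb y => by
        rw [ha y, hb (y + a), add_assoc]
      zero_mem' := fun y => by rw [add_zero]
      neg_mem' := fun {a} ha y => by
        rw [ha (y + -a), neg_add_cancel_right] }
  -- The number of `y` in the class `T` of `z` with `y - g ∈ T` depends only on the class of `g`. If
  -- it is `|T|` for `g`, it is so throughout that class; hence the stabiliser of `T` contains the
  -- class of `h`.
  have sub_mem : ∀ g, (∀ y, Sim l y z → Sim l (y - g) z) → ∀ g', Sim l g' g →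
      ∀ y, Sim l y z → Sim l (y - g') z := by
    intro g hg g' hg'
    have e := H.count z (-z) g' g hg'
    have e' : (Finset.univ.filter fun y => Sim l y z ∧ Sim l (g - y) (-z)) =
        Finset.univ.filter fun y => Sim l y z := by
      refine Finset.filter_congr fun y _ => and_iff_left_of_imp fun hy => ?_
      have := hg y hy
      refine ⟨?_, ?_⟩
      · rw [← this.2, neg_sub]
      · rw [neg_neg, neg_sub, this.1]
    rw [e'] at e
    have e'' := Finset.eq_of_subset_of_card_le (Finset.monotone_filter_right _
      (fun y _ h => h.1)) e.ge
    intro y hy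
    have := Finset.ext_iff.1 e'' y
    simp only [Finset.mem_filter, Finset.mem_univ, true_and] at this
    have := (this.2 hy).2
    refine ⟨?_, ?_⟩
    · have := this.2
      rwa [neg_sub, neg_neg] at this
    · rw [neg_sub, this.1]
  have hK := hprim K h hne fun g hg => by
    have h1 := sub_mem h (fun y hy => by
      rw [hh, sub_add_cancel]
      exact hy) g hg
    have h2 := sub_mem (-h) (fun y hy => by
      rw [sub_neg_eq_add, ← hh]
      exact hy) (-g) ⟨hg.2, by rw [neg_neg, neg_neg]; exact hg.1⟩
    intro y
    constructor
    · intro hy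
      have := h2 y hy
      rwa [sub_neg_eq_add] at this
    · intro hy
      have := h1 _ hy
      rwa [add_sub_cancel_right] at this
  have hmem : -z ∈ K := by rw [hK]; trivial
  have := ((hmem z).1 ⟨rfl, rfl⟩).1
  rw [add_neg_cancel, (H.eq_zero_iff 0).2 rfl] at this
  exact hz ((H.eq_zero_iff z).1 this.symm)

variable [DecidableEq G] {p : ℕ} (hp : p.Prime)
  (hle : (Finset.univ.filter fun x : G => p • x = 0).card ≤ p)
  {m : G} (hm : m ≠ 0) (hpm : p • m = 0)
include hp hle hm hpm

omit hm hpm hprim H hp in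
theorem card_nsmul_fiber_le (z : G) : (Finset.univ.filter fun x : G => p • x = p • z).card ≤ p := by
  refine le_trans (Finset.card_le_card_of_injOn (fun x => x - z) ?_ ?_) hle
  · intro x hx
    simp only [Finset.coe_filter, Finset.mem_univ, true_and, Set.mem_ofPred_eq] at hx ⊢
    rw [nsmul_sub, hx, sub_self]
  · exact fun x _ y _ h => sub_left_injective h

/-- If `p` did not divide the number of elements of the class in this fibre, Schur's theorem would
put the class of `p • z` inside `pG`, making `pG = G` against the torsion element `m`. So that
number is at least `p`, the maximal size of a fibre. -/
theorem fiber_subset {c z x : G} (hzc : Sim l z c) (hz : p • z ≠ 0) (hx : p • x = p • z) :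
    Sim l x c := by
  have := Fact.mk hp
  have hdvd : p ∣ (Finset.univ.filter fun y => Sim l y c ∧ p • y = p • z).card := by
    by_contra hnd
    have htop := hprim (AddMonoidHom.range (nsmulAddMonoidHom (α := G) p)) _ hz fun y hy => by
      have e := H.natCast_card_nsmul_eq p c hy
      have e' : (Finset.univ.filter fun x => Sim l x c ∧ p • x = y).card ≠ 0 := by
        intro h0
        rw [h0, Nat.cast_zero, eq_comm, ZMod.natCast_eq_zero_iff] at e
        exact hnd e
      obtain ⟨w, hw⟩ := Finset.card_ne_zero.1 e'
      simp only [Finset.mem_filter, Finset.mem_univ, true_and] at hw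
      exact ⟨w, hw.2⟩
    have hinj := Finite.injective_iff_surjective.2 (AddMonoidHom.range_eq_top.1 htop)
    exact hm (hinj (by simp [hpm]))
  have hzmem : z ∈ Finset.univ.filter fun y => Sim l y c ∧ p • y = p • z := by simp [hzc]
  have hge := Nat.le_of_dvd (Finset.card_pos.2 ⟨z, hzmem⟩) hdvd
  have heq := Finset.eq_of_subset_of_card_le
    (Finset.monotone_filter_right Finset.univ (fun y _ h => h.2) :
      (Finset.univ.filter fun y => Sim l y c ∧ p • y = p • z) ⊆
        Finset.univ.filter fun y => p • y = p • z) ((card_nsmul_fiber_le hle z).trans hge)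
  have := Finset.ext_iff.1 heq x
  simp only [Finset.mem_filter, Finset.mem_univ, true_and] at this
  exact (this.2 hx).1

/-- A class without `p`-torsion would be a union of full fibres, hence invariant under translation
by `m`. -/
theorem exists_sim_torsion {z : G} (hz : z ≠ 0) : ∃ h, Sim l h z ∧ p • h = 0 := by
  by_contra! hcon
  refine hm (H.eq_zero_of_translate hprim hz (h := m) fun y => ⟨fun hy => ?_, fun hy => ?_⟩)
  · exact H.fiber_subset hprim hp hle hm hpm hy (hcon y hy) (by rw [nsmul_add, hpm, add_zero])
  · exact H.fiber_subset hprim hp hle hm hpm hy (hcon _ hy) (by rw [nsmul_add, hpm, add_zero])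

/-- A primitive Schur ring over a group with few elements of order `p`, some but not all of whose
elements have order `p`, has only symmetric basic sets. -/
theorem sim_neg_of_composite {c : G} (hc : c ≠ 0) (htop : ∃ x : G, p • x ≠ 0) : Sim l c (-c) := by
  by_contra hns
  obtain ⟨x₀, hx₀c, hx₀⟩ : ∃ x, Sim l x c ∧ p • x ≠ 0 := by
    by_contra! hcon
    obtain ⟨x, hx⟩ := htop
    have := hprim (nsmulAddMonoidHom (α := G) p).ker c hc fun y hy => hcon y hy
    have hmem : x ∈ (nsmulAddMonoidHom (α := G) p).ker := by rw [this]; trivial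
    exact hx hmem
  set T := Finset.univ.filter fun x => Sim l x c with hT
  set T₀ := Finset.univ.filter fun x => Sim l x c ∧ p • x = 0 with hT₀
  set T₁ := Finset.univ.filter fun x => Sim l x c ∧ p • x ≠ 0 with hT₁
  have hsum : T₀.card + T₁.card = T.card := by
    rw [hT₀, hT₁, ← Finset.filter_filter, ← Finset.filter_filter]
    exact Finset.card_filter_add_card_filter_not _
  have hzero : ∀ x, Sim l x c → x ≠ 0 := by
    rintro x hx rfl
    have := hx.1
    rw [(H.eq_zero_iff 0).2 rfl] at this
    exact hc ((H.eq_zero_iff c).1 this.symm)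
  have hT₀p : T₀.card < p := by
    refine lt_of_lt_of_le (Finset.card_lt_card ?_) hle
    refine Finset.ssubset_iff_of_subset ?_ |>.2 ⟨0, by simp, ?_⟩
    · exact Finset.monotone_filter_right _ (fun y _ h => h.2)
    · simp only [hT₀, Finset.mem_filter, Finset.mem_univ, true_and, not_and]
      exact fun h => absurd rfl (hzero 0 h)
  have hT₁p : p ≤ T₁.card := by
    have h1 : p ≤ (Finset.univ.filter fun y => Sim l y c ∧ p • y = p • x₀).card := by
      have hpos : 0 < (Finset.univ.filter fun y => Sim l y c ∧ p • y = p • x₀).card :=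
        Finset.card_pos.2 ⟨x₀, by simp [hx₀c]⟩
      have := Fact.mk hp
      have hord : addOrderOf m = p := addOrderOf_eq_prime hpm hm
      have := Finset.card_le_card_of_injOn (s := Finset.range p)
        (t := Finset.univ.filter fun y => Sim l y c ∧ p • y = p • x₀) (fun k => x₀ + k • m) ?_ ?_
      · rwa [Finset.card_range] at this
      · intro k _
        have hk : p • (x₀ + k • m) = p • x₀ := by
          rw [nsmul_add, smul_comm, hpm, smul_zero, add_zero]
        simp only [Finset.coe_filter, Finset.mem_univ, true_and, Set.mem_ofPred_eq]
        exact ⟨H.fiber_subset hprim hp hle hm hpm hx₀c hx₀ hk, hk⟩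
      · intro i hi j hj hij
        refine nsmul_injOn_Iio_addOrderOf ?_ ?_ (add_left_cancel hij)
        · simpa [hord] using hi
        · simpa [hord] using hj
    refine h1.trans (Finset.card_le_card (Finset.monotone_filter_right _ fun y _ h => ⟨h.1, ?_⟩))
    rw [h.2]
    exact hx₀
  -- every nonzero element is a difference of elements of `T` in at least `T₁.card` ways
  have hrep : ∀ z : G, z ≠ 0 →
      T₁.card ≤ (Finset.univ.filter fun y => Sim l y c ∧ Sim l (z - y) (-c)).card := by
    intro z hz
    -- The number of representations depends only on the class of `z`, so `z` may be replaced by a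
    -- `p`-torsion element `h`. For `y ∈ T₁`, `y - h` is in the same fibre as `y`, hence in `T`.
    obtain ⟨h, hhz, hph⟩ := H.exists_sim_torsion hprim hp hle hm hpm hz
    rw [← H.count c (-c) h z hhz]
    refine Finset.card_le_card (Finset.monotone_filter_right _ fun y _ hy => ⟨hy.1, ?_⟩)
    have := H.fiber_subset hprim hp hle hm hpm hy.1 hy.2 (x := y - h) (by
      rw [nsmul_sub, hph, sub_zero])
    exact ⟨by rw [← this.2, neg_sub], by rw [neg_neg, neg_sub, this.1]⟩
  have hTneg : (Finset.univ.filter fun x => Sim l x (-c)).card = T.card := by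
    have hneg : ∀ x, Sim l (-x) c ↔ Sim l x (-c) := by
      intro x
      rw [Sim, Sim, neg_neg, neg_neg]
      exact and_comm
    refine Finset.card_nbij' (fun x => -x) (fun x => -x) ?_ ?_ ?_ ?_
    · intro x hx
      simpa [hT, hneg] using hx
    · intro x hx
      simpa [hT, ← hneg] using hx
    · exact fun x _ => neg_neg x
    · exact fun x _ => neg_neg x
  have htotal : ∑ z, (Finset.univ.filter fun y => Sim l y c ∧ Sim l (z - y) (-c)).card =
      T.card * T.card := by
    simp only [← Finset.filter_filter, Finset.card_filter _ (Finset.filter _ _)]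
    rw [Finset.sum_comm, ← smul_eq_mul, ← Finset.sum_const]
    refine Finset.sum_congr rfl fun y _ => ?_
    rw [← Finset.card_filter, ← hTneg]
    refine Finset.card_nbij' (fun z => z - y) (fun z => z + y) ?_ ?_ ?_ ?_
    · intro x; simp
    · intro x; simp
    · intro x; simp
    · intro x; simp
  have h0 : (Finset.univ.filter fun y => Sim l y c ∧ Sim l (0 - y) (-c)).card = T.card := by
    refine congrArg Finset.card (Finset.filter_congr fun y _ => and_iff_left_of_imp fun hy => ?_)
    rw [zero_sub]
    exact ⟨hy.2, by rw [neg_neg, neg_neg]; exact hy.1⟩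
  have hlow : (Fintype.card G - 1) * T₁.card + T.card ≤ T.card * T.card := by
    rw [← htotal, ← Finset.sum_erase_add _ _ (Finset.mem_univ (0 : G)), h0]
    refine Nat.add_le_add_right ?_ _
    have := Finset.card_nsmul_le_sum (Finset.univ.erase (0 : G))
      (fun z => (Finset.univ.filter fun y => Sim l y c ∧ Sim l (z - y) (-c)).card) T₁.card
      (fun z hz => hrep z (Finset.ne_of_mem_erase hz))
    rwa [Finset.card_erase_of_mem (Finset.mem_univ _), smul_eq_mul, Finset.card_univ] at this
  have hhalf : 2 * T.card ≤ Fintype.card G - 1 := by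
    have hdis : Disjoint T (Finset.univ.filter fun x => Sim l x (-c)) := by
      rw [Finset.disjoint_filter]
      exact fun x _ h h' => hns (h.symm.trans h')
    have h1 := Finset.card_union_of_disjoint hdis
    have h2 : T ∪ (Finset.univ.filter fun x => Sim l x (-c)) ⊆ Finset.univ.erase 0 := by
      intro x hx
      rw [Finset.mem_erase]
      refine ⟨?_, Finset.mem_univ _⟩
      rcases Finset.mem_union.1 hx with hx | hx
      · exact hzero x (by simpa [hT] using hx)
      · rintro rfl
        have : Sim l (0 : G) (-c) := by simpa using hx
        refine hzero 0 ⟨?_, ?_⟩ rfl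
        · rw [← neg_zero, this.2, neg_neg]
        · rw [neg_zero, this.1]
    have h3 := Finset.card_le_card h2
    rw [Finset.card_erase_of_mem (Finset.mem_univ _), Finset.card_univ, h1, hTneg] at h3
    omega
  have hfin : 2 * T.card * T₁.card ≤ (Fintype.card G - 1) * T₁.card :=
    Nat.mul_le_mul_right _ hhalf
  have hpos := hp.pos
  -- From `(|G| - 1)|T₁| + |T| ≤ |T|²` and `2|T| ≤ |G| - 1`. This contradicts `|T| = |T₀| + |T₁| < p
  -- + |T₁| ≤ 2|T₁|`.
  have : 2 * T₁.card + 1 ≤ T.card := by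
    have h4 : T.card * (2 * T₁.card + 1) ≤ T.card * T.card := by nlinarith
    exact Nat.le_of_mul_le_mul_left h4 (by omega)
  omega

end Primitive

/-- A primitive Schur ring over a cyclic group, with a basic set that is not symmetric, lives over
a group of prime order. -/
theorem prime_of_primitive {n : ℕ} [NeZero n] {l : ZMod n → ℕ} (H : IsSchurLength l)
    (hprim : ∀ (K : AddSubgroup (ZMod n)) (x : ZMod n), x ≠ 0 → (∀ y, Sim l y x → y ∈ K) → K = ⊤)
    {c : ZMod n} (hc : ¬ Sim l c (-c)) : n.Prime := by
  have hc0 : c ≠ 0 := by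
    rintro rfl
    rw [neg_zero] at hc
    exact hc ⟨rfl, rfl⟩
  have hn1 : n ≠ 1 := by
    rintro rfl
    exact hc0 (Subsingleton.elim _ _)
  by_contra hnp
  have hp := Nat.minFac_prime hn1
  obtain ⟨k, hk⟩ := n.minFac_dvd
  have hn0 := NeZero.ne n
  have hpn : n.minFac < n := lt_of_le_of_ne (Nat.minFac_le (Nat.pos_of_ne_zero hn0)) fun h =>
    hnp (h ▸ hp)
  have hk0 : 0 < k := Nat.pos_of_ne_zero fun h => hn0 (by rw [hk, h, mul_zero])
  have hkn : k < n := by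
    have := hp.two_le
    nlinarith
  -- Here `p` is the least prime factor of `n` and `m = n / p`; the element `1` is not `p`-torsion
  -- since `p < n`.
  refine hc (H.sim_neg_of_composite hprim hp ?_ (m := (k : ZMod n)) ?_ ?_ hc0 ⟨1, ?_⟩)
  · exact IsAddCyclic.card_nsmul_eq_zero_le hp.pos
  · rw [Ne, ZMod.natCast_eq_zero_iff]
    exact Nat.not_dvd_of_pos_of_lt hk0 hkn
  · rw [nsmul_eq_mul, ← Nat.cast_mul, ← hk, ZMod.natCast_self]
  · rw [nsmul_eq_mul, mul_one, Ne, ZMod.natCast_eq_zero_iff]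
    exact Nat.not_dvd_of_pos_of_lt hp.pos hpn

end IsSchurLength

end CyclotomicLength

/-! ### From digraphs to word lengths -/

open CyclotomicLength

namespace Digraph

section Dist

variable {V W : Type*} {Γ : Digraph V} {Δ : Digraph W}

theorem IsWalk.append {m n : ℕ} {x y z : V} (h : Γ.IsWalk m x y) (h' : Γ.IsWalk n y z) :
    Γ.IsWalk (m + n) x z := by
  induction h with
  | nil x => rwa [zero_add]
  | cons hadj _ ih =>
    rw [Nat.add_right_comm]
    exact IsWalk.cons hadj (ih h')

theorem isWalk_zero_iff {x y : V} : Γ.IsWalk 0 x y ↔ x = y := by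
  constructor
  · rintro ⟨⟩
    rfl
  · rintro rfl
    exact IsWalk.nil x

theorem isWalk_one_iff {x y : V} : Γ.IsWalk 1 x y ↔ Γ.Adj x y := by
  constructor
  · rintro (_ | ⟨h, h'⟩)
    rwa [← isWalk_zero_iff.1 h']
  · exact fun h => IsWalk.cons h (IsWalk.nil y)

theorem IsWalk.map (f : Γ.Adj ≃r Δ.Adj) {n : ℕ} {x y : V} (h : Γ.IsWalk n x y) :
    Δ.IsWalk n (f x) (f y) := by
  induction h with
  | nil x => exact IsWalk.nil _
  | cons hadj _ ih => exact IsWalk.cons (f.map_rel_iff.2 hadj) ih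

theorem isWalk_map_iff (f : Γ.Adj ≃r Δ.Adj) {n : ℕ} {x y : V} :
    Δ.IsWalk n (f x) (f y) ↔ Γ.IsWalk n x y := by
  refine ⟨fun h => ?_, fun h => h.map f⟩
  simpa using h.map f.symm

theorem dist_map (f : Γ.Adj ≃r Δ.Adj) (x y : V) : Δ.dist (f x) (f y) = Γ.dist x y := by
  simp only [dist, isWalk_map_iff]

theorem twoWayDist_map (f : Γ.Adj ≃r Δ.Adj) (x y : V) :
    Δ.twoWayDist (f x) (f y) = Γ.twoWayDist x y := by
  simp only [twoWayDist, dist_map]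

theorem dist_le {n : ℕ} {x y : V} (h : Γ.IsWalk n x y) : Γ.dist x y ≤ n :=
  iInf₂_le n h

theorem exists_dist_eq {x y : V} (h : ∃ n, Γ.IsWalk n x y) :
    ∃ n : ℕ, Γ.dist x y = n ∧ Γ.IsWalk n x y := by
  classical
  refine ⟨Nat.find h, le_antisymm (dist_le (Nat.find_spec h)) ?_, Nat.find_spec h⟩
  exact le_iInf₂ fun n hn => Nat.cast_le.2 (Nat.find_min' h hn)

theorem dist_eq_zero_iff {x y : V} : Γ.dist x y = 0 ↔ x = y := by
  constructor
  · intro h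
    by_cases hw : ∃ n, Γ.IsWalk n x y
    · obtain ⟨n, hn, hn'⟩ := exists_dist_eq hw
      rw [h, eq_comm, Nat.cast_eq_zero] at hn
      subst hn
      exact isWalk_zero_iff.1 hn'
    · push Not at hw
      simp [dist, hw] at h
  · rintro rfl
    exact le_antisymm (by simpa using dist_le (IsWalk.nil x)) zero_le

theorem twoWayDist_eq_zero_iff {x y : V} : Γ.twoWayDist x y = (0, 0) ↔ x = y := by
  rw [twoWayDist, Prod.mk_inj, dist_eq_zero_iff, dist_eq_zero_iff, eq_comm (a := y), and_self]

theorem mem_distRel_iff {x y : V} {i : ℕ∞ × ℕ∞} : (x, y) ∈ Γ.distRel i ↔ Γ.twoWayDist x y = i :=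
  Iff.rfl

theorem distRel_zero : Γ.distRel (0, 0) = Set.diagonal V := by
  ext ⟨x, y⟩
  rw [mem_distRel_iff, twoWayDist_eq_zero_iff, Set.mem_diagonal_iff]

theorem mem_attachedScheme_iff {R : Set (V × V)} :
    R ∈ Γ.attachedScheme ↔ ∃ x y, Γ.distRel (Γ.twoWayDist x y) = R := by
  constructor
  · rintro ⟨_, ⟨x, y, rfl⟩, rfl⟩
    exact ⟨x, y, rfl⟩
  · rintro ⟨x, y, rfl⟩
    exact ⟨_, ⟨x, y, rfl⟩, rfl⟩

theorem twoWayDist_swap (x y : V) : Γ.twoWayDist y x = (Γ.twoWayDist x y).swap := rfl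

theorem swap_preimage_distRel (i : ℕ∞ × ℕ∞) :
    Prod.swap ⁻¹' Γ.distRel i = Γ.distRel i.swap := by
  ext ⟨x, y⟩
  rw [Set.mem_preimage, Prod.swap_prod_mk, mem_distRel_iff, mem_distRel_iff, twoWayDist_swap x y,
    Prod.swap_eq_iff_eq_swap]

/-- If the automorphism group is transitive on the pairs with each two-way distance, then the
two-way distance relations form an association scheme. -/
theorem isAssociationScheme_of_transitive [Finite V] [Nonempty V]
    (h : ∀ x y x' y', Γ.twoWayDist x y = Γ.twoWayDist x' y' →
      ∃ g : Γ.Adj ≃r Γ.Adj, g x = x' ∧ g y = y') :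
    AssocScheme.IsAssociationScheme Γ.attachedScheme where
  finite := inferInstance
  nonempty := by
    rintro _ ⟨_, ⟨x, y, rfl⟩, rfl⟩
    exact ⟨(x, y), rfl⟩
  diagonal_mem := by
    obtain ⟨x⟩ := ‹Nonempty V›
    exact ⟨(0, 0), ⟨x, x, twoWayDist_eq_zero_iff.2 rfl⟩, distRel_zero⟩
  cover := by
    rw [Set.eq_univ_iff_forall]
    rintro ⟨x, y⟩
    exact ⟨_, ⟨_, ⟨x, y, rfl⟩, rfl⟩, rfl⟩
  disjoint := by
    rintro _ ⟨i, -, rfl⟩ _ ⟨j, -, rfl⟩ hne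
    rw [Set.disjoint_left]
    rintro ⟨x, y⟩ hi hj
    rw [mem_distRel_iff] at hi hj
    exact hne (by rw [← hi, hj])
  transpose_mem := by
    rintro _ ⟨_, ⟨x, y, rfl⟩, rfl⟩
    rw [swap_preimage_distRel]
    exact ⟨_, ⟨y, x, rfl⟩, rfl⟩
  card_const := by
    rintro _ ⟨i, -, rfl⟩ _ ⟨j, -, rfl⟩ _ ⟨_, ⟨x₀, y₀, rfl⟩, rfl⟩
    refine ⟨(AssocScheme.P (Γ.distRel i) (Γ.distRel j) x₀ y₀).ncard, fun x y hxy => ?_⟩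
    obtain ⟨g, rfl, rfl⟩ := h x y x₀ y₀ hxy
    refine Set.ncard_congr (fun z _ => g z) ?_ (fun z w _ _ hzw => g.injective hzw) ?_
    · rintro z ⟨h1, h2⟩
      rw [mem_distRel_iff] at h1 h2
      exact ⟨(twoWayDist_map g _ _).trans h1, (twoWayDist_map g _ _).trans h2⟩
    · rintro z ⟨h1, h2⟩
      rw [mem_distRel_iff] at h1 h2
      refine ⟨g.symm z, ⟨?_, ?_⟩, g.apply_symm_apply z⟩
      · rw [mem_distRel_iff, ← twoWayDist_map g, g.apply_symm_apply, h1]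
      · rw [mem_distRel_iff, ← twoWayDist_map g, g.apply_symm_apply, h2]

end Dist

section Cayley

variable {V : Type*} {Γ : Digraph V} {G : Type*} [AddCommGroup G] {S : Set G}

/-- Translation by `a` as an automorphism of a Cayley digraph. -/
def cayleyTranslate (S : Set G) (a : G) : (cayley S).Adj ≃r (cayley S).Adj where
  toEquiv := Equiv.addRight a
  map_rel_iff' := by simp [cayley]

theorem cayleyTranslate_apply (a x : G) : cayleyTranslate S a x = x + a := rfl

theorem cayley_dist_eq (x y : G) : (cayley S).dist x y = (cayley S).dist 0 (y - x) := by
  have := dist_map (cayleyTranslate S (-x)) x y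
  rw [← this, cayleyTranslate_apply, cayleyTranslate_apply, add_neg_cancel, sub_eq_add_neg]

theorem twoWayDist_eq_of_iso (f : Γ.Adj ≃r (cayley S).Adj) (x y : V) :
    Γ.twoWayDist x y = (cayley S).twoWayDist 0 (f y - f x) := by
  rw [← twoWayDist_map f, twoWayDist, twoWayDist, cayley_dist_eq (f x), cayley_dist_eq (f y),
    cayley_dist_eq (f y - f x) 0]
  simp

/-- The word length with respect to `S`. -/
noncomputable def wordLength (S : Set G) (x : G) : ℕ :=
  ((cayley S).dist 0 x).toNat

variable (hS : (cayley S).IsStronglyConnected)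
include hS

/-- Strong connectivity matters: `ENat.toNat` would send an infinite distance to `0`. -/
theorem dist_zero_eq_wordLength (x : G) : (cayley S).dist 0 x = wordLength S x := by
  obtain ⟨n, hn, -⟩ := exists_dist_eq (hS 0 x)
  rw [wordLength, hn, ENat.toNat_natCast]

theorem isWalk_wordLength (x : G) : (cayley S).IsWalk (wordLength S x) 0 x := by
  obtain ⟨n, hn, hn'⟩ := exists_dist_eq (hS 0 x)
  rwa [wordLength, hn, ENat.toNat_natCast]

theorem wordLength_le {n : ℕ} {x : G} (h : (cayley S).IsWalk n 0 x) : wordLength S x ≤ n := by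
  have := dist_le h
  rw [dist_zero_eq_wordLength hS] at this
  exact_mod_cast this

theorem twoWayDist_zero_eq_iff (x y : G) :
    (cayley S).twoWayDist 0 x = (cayley S).twoWayDist 0 y ↔ Sim (wordLength S) x y := by
  rw [twoWayDist, twoWayDist, cayley_dist_eq x, cayley_dist_eq y, zero_sub, zero_sub]
  simp only [dist_zero_eq_wordLength hS, Prod.mk_inj, Nat.cast_inj, Sim]

theorem wordLength_eq_zero_iff (x : G) : wordLength S x = 0 ↔ x = 0 := by
  have := dist_eq_zero_iff (Γ := cayley S) (x := 0) (y := x)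
  rw [dist_zero_eq_wordLength hS, Nat.cast_eq_zero, eq_comm (a := (0 : G))] at this
  exact this

theorem wordLength_add_le (x y : G) :
    wordLength S (x + y) ≤ wordLength S x + wordLength S y := by
  refine wordLength_le hS ((isWalk_wordLength hS x).append ?_)
  have := (isWalk_wordLength hS y).map (cayleyTranslate S x)
  simpa [cayleyTranslate_apply, add_comm] using this

theorem wordLength_eq_one_iff (h0 : (0 : G) ∉ S) (x : G) : wordLength S x = 1 ↔ x ∈ S := by
  constructor
  · intro h
    have := isWalk_wordLength hS x
    rw [h, isWalk_one_iff] at this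
    simpa [cayley] using this
  · intro h
    have h1 : (cayley S).IsWalk 1 0 x := isWalk_one_iff.2 (by simpa [cayley] using h)
    have h2 := wordLength_le hS h1
    have h3 : wordLength S x ≠ 0 := by
      rw [Ne, wordLength_eq_zero_iff hS]
      rintro rfl
      exact h0 h
    omega

theorem exists_wordLength_sub (h0 : (0 : G) ∉ S) {x : G} {n : ℕ} (hx : wordLength S x = n + 1) :
    ∃ s, wordLength S s = 1 ∧ wordLength S (x - s) = n := by
  have h := isWalk_wordLength hS x
  rw [hx] at h
  rcases h with _ | ⟨hadj, hw⟩
  rename_i s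
  have hs : wordLength S s = 1 := by
    rw [wordLength_eq_one_iff hS h0]
    simpa [cayley] using hadj
  refine ⟨s, hs, ?_⟩
  have h1 := hw.map (cayleyTranslate S (-s))
  have h2 := wordLength_le hS (x := x - s) (n := n)
    (by simpa [cayleyTranslate_apply, sub_eq_add_neg] using h1)
  have h3 := wordLength_add_le hS (x - s) s
  rw [sub_add_cancel, hx, hs] at h3
  omega

variable (f : Γ.Adj ≃r (cayley S).Adj)
include f

omit hS in
theorem isStronglyConnected_of_iso (h : Γ.IsStronglyConnected) : (cayley S).IsStronglyConnected := by
  intro x y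
  obtain ⟨n, hn⟩ := h (f.symm x) (f.symm y)
  exact ⟨n, by simpa using hn.map f⟩

theorem isSchurLength_wordLength [Fintype G] (hW : Γ.IsWeaklyDistanceRegular) :
    IsSchurLength (wordLength S) where
  eq_zero_iff := wordLength_eq_zero_iff hS
  count a b z z' hz := by
    have htwd : ∀ x y, Γ.twoWayDist (f.symm x) (f.symm y) = (cayley S).twoWayDist 0 (y - x) := by
      intro x y
      rw [twoWayDist_eq_of_iso f, f.apply_symm_apply, f.apply_symm_apply]
    obtain ⟨k, hk⟩ := hW.2.card_const _ (mem_attachedScheme_iff.2 ⟨f.symm 0, f.symm a, rfl⟩)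
      _ (mem_attachedScheme_iff.2 ⟨f.symm 0, f.symm b, rfl⟩)
      _ (mem_attachedScheme_iff.2 ⟨f.symm 0, f.symm z, rfl⟩)
    simp only [htwd, sub_zero] at hk
    have key : ∀ w, Sim (wordLength S) w z → (Finset.univ.filter fun y =>
        Sim (wordLength S) y a ∧ Sim (wordLength S) (w - y) b).card = k := by
      intro w hw
      rw [← hk (f.symm 0) (f.symm w) (by
        rw [mem_distRel_iff, htwd, sub_zero, twoWayDist_zero_eq_iff hS]
        exact hw), ← Set.ncard_coe_finset]
      refine Set.ncard_congr (fun y _ => f.symm y) ?_ (fun x y _ _ h => f.symm.injective h) ?_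
      · intro y hy
        simp only [Finset.coe_filter, Finset.mem_univ, true_and, Set.mem_ofPred_eq] at hy
        constructor
        · rw [mem_distRel_iff, htwd, sub_zero, twoWayDist_zero_eq_iff hS]
          exact hy.1
        · rw [mem_distRel_iff, htwd, twoWayDist_zero_eq_iff hS]
          exact hy.2
      · rintro v ⟨h1, h2⟩
        refine ⟨f v, ?_, f.symm_apply_apply v⟩
        rw [mem_distRel_iff, twoWayDist_eq_of_iso f, f.apply_symm_apply,
          twoWayDist_zero_eq_iff hS] at h1 h2
        rw [sub_zero] at h1
        simp only [Finset.coe_filter, Finset.mem_univ, true_and, Set.mem_ofPred_eq]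
        exact ⟨h1, h2⟩
    rw [key z ⟨rfl, rfl⟩, key z' hz.symm]

theorem eq_top_of_isPrimitive (hW : Γ.IsWeaklyDistanceRegular) (hP : Γ.IsPrimitive)
    (K : AddSubgroup G) (x : G) (hx : x ≠ 0) (hK : ∀ y, Sim (wordLength S) y x → y ∈ K) :
    K = ⊤ := by
  have hdiag : Γ.distRel (Γ.twoWayDist (f.symm 0) (f.symm x)) ≠ Set.diagonal V := by
    intro h
    have : (f.symm 0, f.symm x) ∈ Set.diagonal V := by
      rw [← h]
      exact rfl
    rw [Set.mem_diagonal_iff] at this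
    exact hx (f.symm.injective this).symm
  have hmem : Γ.distRel (Γ.twoWayDist (f.symm 0) (f.symm x)) ∈ Γ.attachedScheme :=
    mem_attachedScheme_iff.2 ⟨f.symm 0, f.symm x, rfl⟩
  have hgen := hP _ hmem hdiag
  obtain ⟨-, hleast⟩ := hgen
  -- The relations all of whose differences lie in `K` form a closed subset, because `K` is closed
  -- under subtraction.
  have hsub := @hleast {R | R ∈ Γ.attachedScheme ∧ ∀ u v, (u, v) ∈ R → f v - f u ∈ K} ?_
  · rw [AddSubgroup.eq_top_iff']
    intro g
    have := (hsub (mem_attachedScheme_iff.2 ⟨f.symm 0, f.symm g, rfl⟩)).2 (f.symm 0) (f.symm g) rfl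
    simpa using this
  · have hR : ∀ u v, (u, v) ∈ Γ.distRel (Γ.twoWayDist (f.symm 0) (f.symm x)) → f v - f u ∈ K := by
      intro u v huv
      apply hK
      rw [mem_distRel_iff, twoWayDist_eq_of_iso f, twoWayDist_eq_of_iso f, f.apply_symm_apply,
        f.apply_symm_apply, sub_zero, twoWayDist_zero_eq_iff hS] at huv
      exact huv
    refine ⟨⟨⟨_, hmem, hR⟩, fun R hR => hR.1, ?_⟩, hmem, hR⟩
    rintro R ⟨hR, hRK⟩ R' ⟨hR', hRK'⟩ T ⟨hT, _, rfl, _, rfl, hne⟩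
    refine ⟨hT, fun u v huv => ?_⟩
    rw [AssocScheme.interNum_eq hW.2 (hW.2.transpose_mem R hR) hR' hT huv] at hne
    obtain ⟨w, hw, hw'⟩ := Set.nonempty_of_ncard_ne_zero hne
    have := K.sub_mem (hRK' w v hw') (hRK w u hw)
    simpa using this

omit hS f in
theorem exists_zmod_iso_of_isCirculant (hΓ : Γ.IsCirculant) :
    ∃ (n : ℕ) (_ : NeZero n) (S : Set (ZMod n)), 0 ∉ S ∧ Nonempty (Γ.Adj ≃r (cayley S).Adj) := by
  obtain ⟨G, _, _, hcyc, S, h0, ⟨f⟩⟩ := hΓ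
  let e := zmodAddCyclicAddEquiv hcyc
  refine ⟨Nat.card G, ⟨Nat.card_pos.ne'⟩, e ⁻¹' S, by simpa using h0, ⟨f.trans ⟨e.symm, ?_⟩⟩⟩
  intro x y
  simp [cayley, ← map_sub]

omit hS f in
/-- Multiplication by a unit as an isomorphism of Cayley digraphs. -/
theorem isIsomorphic_cayley_of_mul {F : Type*} [Field F] {S T : Set F} (f : Γ.Adj ≃r (cayley S).Adj)
    {s : F} (hs : s ≠ 0) (hST : ∀ x, s * x ∈ S ↔ x ∈ T) : Γ.IsIsomorphic (cayley T) := by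
  refine ⟨f.trans (RelIso.symm ⟨Equiv.mulLeft₀ s hs, ?_⟩)⟩
  intro x y
  simp [cayley, ← mul_sub, hST]

end Cayley

end Digraph

/-! ### Primitive circulants are in the list -/

open CyclotomicLength

namespace Digraph

variable {V : Type*} {Γ : Digraph V}

theorem isCyclotomicLength_wordLength {p : ℕ} [Fact p.Prime] {S : Set (ZMod p)} (h0 : 0 ∉ S)
    (hS : (cayley S).IsStronglyConnected) (H : IsSchurLength (wordLength S))
    (hdir : ∃ s ∈ S, -s ∉ S) : IsCyclotomicLength (wordLength S) where
  eq_zero_iff := wordLength_eq_zero_iff hS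
  add_le := wordLength_add_le hS
  exists_sub _ _ h := exists_wordLength_sub hS h0 h
  mul_sim := H.mul_sim
  directed := by
    obtain ⟨s, hs, hs'⟩ := hdir
    exact ⟨s, (wordLength_eq_one_iff hS h0 s).2 hs,
      fun h => hs' ((wordLength_eq_one_iff hS h0 _).1 h)⟩

theorem mem_squareUnits_iff {F : Type*} [Field F] (x : F) :
    x ∈ {a : F | ∃ u : Fˣ, a = ((u ^ 2 : Fˣ) : F)} ↔ x ≠ 0 ∧ IsSquare x := by
  constructor
  · rintro ⟨u, rfl⟩
    refine ⟨Units.ne_zero _, (u : F), ?_⟩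
    rw [Units.val_pow_eq_pow_val, sq]
  · rintro ⟨h0, y, rfl⟩
    refine ⟨Units.mk0 y (left_ne_zero_of_mul h0), ?_⟩
    rw [Units.val_pow_eq_pow_val, sq, Units.val_mk0]

theorem cube_eq_one_iff_thirteen : ∀ x : ZMod 13, x ^ 3 = 1 ↔ x = 1 ∨ x = 3 ∨ x = 9 := by
  decide

theorem isIsomorphic_of_isPrimitive (hdirected : ¬ ∀ x y, Γ.Adj x y → Γ.Adj y x)
    (hW : Γ.IsWeaklyDistanceRegular) (hP : Γ.IsPrimitive) (hC : Γ.IsCirculant) :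
    (∃ p : ℕ, p.Prime ∧ Γ.IsIsomorphic (cycle p)) ∨
      (∃ (r : ℕ) (_ : Fact r.Prime), r ≡ 3 [MOD 4] ∧ Γ.IsIsomorphic (paley (ZMod r))) ∨
      Γ.IsIsomorphic (cayley ({1, 3, 9} : Set (ZMod 13))) := by
  obtain ⟨n, _, S, h0, ⟨f⟩⟩ := exists_zmod_iso_of_isCirculant hC
  have hS := isStronglyConnected_of_iso f hW.1
  have H := isSchurLength_wordLength hS f hW
  obtain ⟨s, hs, hs'⟩ : ∃ s ∈ S, -s ∉ S := by
    push Not at hdirected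
    obtain ⟨x, y, hxy, hyx⟩ := hdirected
    refine ⟨f y - f x, f.map_rel_iff.2 hxy, fun h => hyx (f.map_rel_iff.1 ?_)⟩
    rwa [neg_sub] at h
  have hns : ¬ Sim (wordLength S) s (-s) := by
    intro h
    have := h.1
    rw [(wordLength_eq_one_iff hS h0 s).2 hs] at this
    exact hs' ((wordLength_eq_one_iff hS h0 _).1 this.symm)
  have hp := H.prime_of_primitive (eq_top_of_isPrimitive hS f hW hP) hns
  have := Fact.mk hp
  obtain ⟨c, hc, h⟩ := (isCyclotomicLength_wordLength h0 hS H ⟨s, hs, hs'⟩).classification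
  simp only [wordLength_eq_one_iff hS h0] at h
  rcases h with h | ⟨h4, h⟩ | ⟨rfl, h⟩
  · exact Or.inl ⟨n, hp, isIsomorphic_cayley_of_mul f hc h⟩
  · refine Or.inr (Or.inl ⟨n, this, h4, isIsomorphic_cayley_of_mul f hc fun x => ?_⟩)
    rw [h, mem_squareUnits_iff]
  · refine Or.inr (Or.inr (isIsomorphic_cayley_of_mul f hc fun x => ?_))
    rw [h, Set.mem_insert_iff, Set.mem_insert_iff, Set.mem_singleton_iff]
    exact cube_eq_one_iff_thirteen x

/-! ### The listed digraphs are primitive and weakly distance-regular -/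

section PrimeOrder

variable {p : ℕ} [Fact p.Prime] {S : Set (ZMod p)}

theorem isStronglyConnected_cayley (h0 : 0 ∉ S) (hne : S.Nonempty) :
    (cayley S).IsStronglyConnected := by
  obtain ⟨s, hs⟩ := hne
  have hs0 : s ≠ 0 := fun h => h0 (h ▸ hs)
  have key : ∀ (k : ℕ) (x : ZMod p), (cayley S).IsWalk k x (x + k * s) := by
    intro k
    induction k with
    | zero => intro x; simpa using IsWalk.nil x
    | succ k ih =>
      intro x
      have hadj : (cayley S).Adj x (x + s) := by simpa [cayley] using hs
      have := IsWalk.cons hadj (ih (x + s))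
      convert this using 1
      push_cast
      ring
  intro x y
  refine ⟨((y - x) / s).val, ?_⟩
  have := key ((y - x) / s).val x
  rwa [ZMod.natCast_zmod_val, div_mul_cancel₀ _ hs0, add_sub_cancel] at this

/-- Affine maps as automorphisms of a Cayley digraph. -/
def cayleyAffine {c : ZMod p} (hc : c ≠ 0) (hcS : ∀ z, c * z ∈ S ↔ z ∈ S) (a b : ZMod p) :
    (cayley S).Adj ≃r (cayley S).Adj where
  toEquiv := ((Equiv.subRight a).trans (Equiv.mulLeft₀ c hc)).trans (Equiv.addRight b)
  map_rel_iff' := by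
    intro x y
    simp only [cayley, Equiv.trans_apply, Equiv.subRight_apply, Equiv.mulLeft₀_apply,
      Equiv.coe_addRight]
    rw [← hcS (y - x)]
    ring_nf

/-- For a closed subset `F`, the `g` with `C g ∈ F` are closed under subtraction. A subgroup of
`Z_p` with a nonzero element is everything. -/
theorem isPrimitive_of_prime [Finite V] (f : Γ.Adj ≃r (cayley S).Adj)
    (hA : AssocScheme.IsAssociationScheme Γ.attachedScheme) : Γ.IsPrimitive := by
  intro R hR hRd
  obtain ⟨x, y, rfl⟩ := mem_attachedScheme_iff.1 hR
  have hxy : f y - f x ≠ 0 := by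
    intro h
    have : x = y := f.injective (sub_eq_zero.1 h).symm
    exact hRd (by rw [twoWayDist_eq_zero_iff.2 this, distRel_zero])
  let C : ZMod p → Set (V × V) := fun g => Γ.distRel ((cayley S).twoWayDist 0 g)
  have hC : ∀ u v, (u, v) ∈ C (f v - f u) := fun u v => twoWayDist_eq_of_iso f u v
  have hCmem : ∀ g, C g ∈ Γ.attachedScheme := by
    intro g
    refine mem_attachedScheme_iff.2 ⟨f.symm 0, f.symm g, ?_⟩
    rw [twoWayDist_eq_of_iso f, f.apply_symm_apply, f.apply_symm_apply, sub_zero]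
  have hCall : ∀ T ∈ Γ.attachedScheme, ∃ g, C g = T := by
    intro T hT
    obtain ⟨u, v, rfl⟩ := mem_attachedScheme_iff.1 hT
    exact ⟨f v - f u, by rw [twoWayDist_eq_of_iso f u v]⟩
  refine ⟨⟨⟨⟨_, hR⟩, subset_rfl, fun _ _ _ _ T hT => hT.1⟩, hR⟩, ?_⟩
  rintro F ⟨⟨-, hF, hclosed⟩, hRF⟩ T hT
  have hsub : ∀ g h, C g ∈ F → C h ∈ F → C (h - g) ∈ F := by
    intro g h hg hh
    refine hclosed _ hg _ hh ⟨hCmem _, _, rfl, _, rfl, ?_⟩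
    have hmem : (f.symm g, f.symm h) ∈ C (h - g) := by
      simpa using hC (f.symm g) (f.symm h)
    rw [AssocScheme.interNum_eq hA (hA.transpose_mem _ (hCmem g)) (hCmem h) (hCmem _) hmem]
    have h1 : (f.symm 0, f.symm g) ∈ C g := by simpa using hC (f.symm 0) (f.symm g)
    have h2 : (f.symm 0, f.symm h) ∈ C h := by simpa using hC (f.symm 0) (f.symm h)
    exact Set.ncard_ne_zero_of_mem (a := f.symm 0) ⟨h1, h2⟩
  have ht : C (f y - f x) ∈ F := by
    have : C (f y - f x) = Γ.distRel (Γ.twoWayDist x y) := by rw [twoWayDist_eq_of_iso f x y]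
    rwa [this]
  have hz : C 0 ∈ F := by simpa using hsub _ _ ht ht
  have hn : ∀ k : ℕ, C (k * (f y - f x)) ∈ F := by
    intro k
    induction k with
    | zero => simpa using hz
    | succ k ih =>
      have := hsub _ _ (by simpa using hsub _ _ ih hz) ht
      convert this using 1
      push_cast
      ring_nf
  obtain ⟨g, rfl⟩ := hCall T hT
  have := hn (g / (f y - f x)).val
  rwa [ZMod.natCast_zmod_val, div_mul_cancel₀ _ hxy] at this

/-- Such multipliers combined with translations are automorphisms, transitive on the pairs at each
two-way distance. -/
theorem isPrimitive_of_sim [Finite V] (f : Γ.Adj ≃r (cayley S).Adj) (h0 : 0 ∉ S)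
    (hne : S.Nonempty) (hsim : ∀ x y, Sim (wordLength S) x y →
      ∃ c, c ≠ 0 ∧ (∀ z, c * z ∈ S ↔ z ∈ S) ∧ y = c * x) :
    Γ.IsWeaklyDistanceRegular ∧ Γ.IsPrimitive ∧ Γ.IsCirculant := by
  have hS := isStronglyConnected_cayley h0 hne
  have : Nonempty V := ⟨f.symm 0⟩
  have hA : AssocScheme.IsAssociationScheme Γ.attachedScheme := by
    refine isAssociationScheme_of_transitive fun x y x' y' h => ?_
    rw [twoWayDist_eq_of_iso f, twoWayDist_eq_of_iso f, twoWayDist_zero_eq_iff hS] at h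
    obtain ⟨c, hc, hcS, he⟩ := hsim _ _ h
    refine ⟨(f.trans (cayleyAffine hc hcS (f x) (f x'))).trans f.symm, ?_, ?_⟩
    · simp [cayleyAffine]
    · simp [cayleyAffine, ← he]
  refine ⟨⟨fun x y => ?_, hA⟩, isPrimitive_of_prime f hA,
    ⟨ZMod p, inferInstance, inferInstance, inferInstance, S, h0, ⟨f⟩⟩⟩
  obtain ⟨n, hn⟩ := hS (f x) (f y)
  exact ⟨n, (isWalk_map_iff f).1 hn⟩

theorem isPrimitive_of_isIsomorphic_cycle [Finite V] (h : Γ.IsIsomorphic (cycle p)) :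
    Γ.IsWeaklyDistanceRegular ∧ Γ.IsPrimitive ∧ Γ.IsCirculant := by
  obtain ⟨f⟩ := h
  have h0 : (0 : ZMod p) ∉ ({1} : Set (ZMod p)) := by simp
  have hne : ({1} : Set (ZMod p)).Nonempty := ⟨1, rfl⟩
  have hwalk : ∀ (k : ℕ) (x y : ZMod p), (cayley ({1} : Set (ZMod p))).IsWalk k x y →
      y = x + k := by
    intro k x y h
    induction h with
    | nil x => simp
    | cons hadj _ ih =>
      have : _ - _ = (1 : ZMod p) := hadj
      rw [ih]
      push_cast
      linear_combination this
  refine isPrimitive_of_sim f h0 hne fun x y h => ⟨1, one_ne_zero, by simp, ?_⟩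
  have hS := isStronglyConnected_cayley h0 hne
  have hx := hwalk _ _ _ (isWalk_wordLength hS x)
  have hy := hwalk _ _ _ (isWalk_wordLength hS y)
  rw [hx, hy, h.1, one_mul]

theorem isPrimitive_of_isIsomorphic_paley [Finite V] (h : Γ.IsIsomorphic (paley (ZMod p))) :
    Γ.IsWeaklyDistanceRegular ∧ Γ.IsPrimitive ∧ Γ.IsCirculant := by
  obtain ⟨f⟩ := h
  set S := {a : ZMod p | ∃ u : (ZMod p)ˣ, a = ((u ^ 2 : (ZMod p)ˣ) : ZMod p)}
  have hmem : ∀ x, x ∈ S ↔ x ≠ 0 ∧ IsSquare x := mem_squareUnits_iff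
  have h0 : (0 : ZMod p) ∉ S := fun h => ((hmem 0).1 h).1 rfl
  have hne : S.Nonempty := ⟨1, (hmem 1).2 ⟨one_ne_zero, IsSquare.one⟩⟩
  have hS := isStronglyConnected_cayley h0 hne
  refine isPrimitive_of_sim f h0 hne fun x y h => ?_
  have hz : x = 0 ↔ y = 0 := by
    rw [← wordLength_eq_zero_iff hS, ← wordLength_eq_zero_iff hS, h.1]
  have hs : x ∈ S ↔ y ∈ S := by
    rw [← wordLength_eq_one_iff hS h0, ← wordLength_eq_one_iff hS h0, h.1]
  by_cases hx : x = 0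
  · exact ⟨1, one_ne_zero, by simp, by rw [hz.1 hx, hx, mul_zero]⟩
  have hy : y ≠ 0 := fun h => hx (hz.2 h)
  -- Length `1` separates squares from nonsquares, so two nonzero elements of equal two-way length
  -- have a square quotient, which is the multiplier.
  have hsq : IsSquare (y / x) := by
    rw [hmem, hmem] at hs
    by_cases hxs : IsSquare x
    · exact (hs.1 ⟨hx, hxs⟩).2.div hxs
    · have hys : ¬ IsSquare y := fun h => hxs (hs.2 ⟨hy, h⟩).2
      have := (isSquare_mul_of_not_isSquare hys hxs).div (IsSquare.mul_self x)
      rwa [mul_div_mul_right _ _ hx] at this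
  refine ⟨y / x, div_ne_zero hy hx, fun z => ?_, (div_mul_cancel₀ _ hx).symm⟩
  rw [hmem, hmem, mul_ne_zero_iff, and_iff_right (div_ne_zero hy hx)]
  refine and_congr_right fun _ => ⟨fun h => ?_, fun h => hsq.mul h⟩
  have := h.div hsq
  rwa [mul_div_cancel_left₀ _ (div_ne_zero hy hx)] at this

end PrimeOrder

/-- The hypotheses express, for `S = {1, 3, 9}`, agreement on whether `l` is `0`, `1` or `2` and
whether `l (-x)` is `1`. This already separates the four cosets of the cube roots of unity. -/
theorem exists_mul_eq_thirteen : ∀ x y : ZMod 13, (x = 0 ↔ y = 0) →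
    (x ^ 3 = 1 ↔ y ^ 3 = 1) →
    ((-x) ^ 3 = 1 ↔ (-y) ^ 3 = 1) →
    (¬ x ^ 3 = 1 →
      ((∃ s, s ^ 3 = 1 ∧ (x - s) ^ 3 = 1) ↔
        ∃ s, s ^ 3 = 1 ∧ (y - s) ^ 3 = 1)) →
    ∃ c, c ^ 3 = 1 ∧ y = c * x := by
  decide +kernel

theorem isPrimitive_of_isIsomorphic_thirteen [Finite V]
    (h : Γ.IsIsomorphic (cayley ({1, 3, 9} : Set (ZMod 13)))) :
    Γ.IsWeaklyDistanceRegular ∧ Γ.IsPrimitive ∧ Γ.IsCirculant := by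
  obtain ⟨f⟩ := h
  have : Fact (Nat.Prime 13) := ⟨by norm_num⟩
  have hmem : ∀ x : ZMod 13, x ∈ ({1, 3, 9} : Set (ZMod 13)) ↔ x ^ 3 = 1 := by
    intro x
    rw [cube_eq_one_iff_thirteen, Set.mem_insert_iff, Set.mem_insert_iff, Set.mem_singleton_iff]
  have h0 : (0 : ZMod 13) ∉ ({1, 3, 9} : Set (ZMod 13)) := by
    rw [hmem]
    simp
  have hne : ({1, 3, 9} : Set (ZMod 13)).Nonempty := ⟨1, (hmem 1).2 (one_pow 3)⟩
  have hS := isStronglyConnected_cayley h0 hne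
  have hone : ∀ x : ZMod 13, wordLength ({1, 3, 9} : Set (ZMod 13)) x = 1 ↔
      x ^ 3 = 1 := fun x => by
    rw [wordLength_eq_one_iff hS h0, hmem]
  have htwo : ∀ x : ZMod 13, x ≠ 0 → ¬ x ^ 3 = 1 →
      (wordLength ({1, 3, 9} : Set (ZMod 13)) x = 2 ↔
        ∃ s, s ^ 3 = 1 ∧ (x - s) ^ 3 = 1) := by
    intro x hx hx1
    rw [← hone] at hx1
    rw [Ne, ← wordLength_eq_zero_iff hS] at hx
    simp only [← hone]
    constructor
    · exact fun h => exists_wordLength_sub hS h0 h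
    · rintro ⟨s, hs, hs'⟩
      have := wordLength_add_le hS (x - s) s
      rw [sub_add_cancel] at this
      omega
  refine isPrimitive_of_sim f h0 hne fun x y h => ?_
  have hz : x = 0 ↔ y = 0 := by
    rw [← wordLength_eq_zero_iff hS, ← wordLength_eq_zero_iff hS, h.1]
  have hxy : x ^ 3 = 1 ↔ y ^ 3 = 1 := by
    rw [← hone, ← hone, h.1]
  by_cases hx : x = 0
  · exact ⟨1, one_ne_zero, by simp, by rw [hz.1 hx, hx, mul_zero]⟩
  obtain ⟨c, hc, hcx⟩ := exists_mul_eq_thirteen x y hz hxy (by rw [← hone, ← hone, h.2])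
    fun hx1 => by
      rw [← htwo x hx hx1, ← htwo y (fun h => hx (hz.2 h)) (fun h => hx1 (hxy.2 h)), h.1]
  refine ⟨c, ?_, fun z => by rw [hmem, hmem, mul_pow, hc, one_mul], hcx⟩
  rintro rfl
  simp at hc

end Digraph

theorem corollary1p3 {V : Type*} [Finite V] (Γ : Digraph V)
    (hsimple : ∀ x, ¬ Γ.Adj x x)
    (hdirected : ¬ ∀ x y, Γ.Adj x y → Γ.Adj y x) :
    (Γ.IsWeaklyDistanceRegular ∧ Γ.IsPrimitive ∧ Γ.IsCirculant) ↔
      ((∃ p : ℕ, p.Prime ∧ Γ.IsIsomorphic (Digraph.cycle p)) ∨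
        (∃ (r : ℕ) (_ : Fact r.Prime), r ≡ 3 [MOD 4] ∧
          Γ.IsIsomorphic (Digraph.paley (ZMod r))) ∨
        Γ.IsIsomorphic (Digraph.cayley ({1, 3, 9} : Set (ZMod 13)))) := by
  constructor
  · rintro ⟨hW, hP, hC⟩
    exact Digraph.isIsomorphic_of_isPrimitive hdirected hW hP hC
  · rintro (⟨p, hp, h⟩ | ⟨r, hr, -, h⟩ | h)
    · have := Fact.mk hp
      exact Digraph.isPrimitive_of_isIsomorphic_cycle h
    · exact Digraph.isPrimitive_of_isIsomorphic_paley h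
    · exact Digraph.isPrimitive_of_isIsomorphic_thirteen h
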